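/- Let $\mathbb{R}^{2,3}$ be $\mathbb{R}^5$ with coordinates $(x_0,\dots,x_4)$, scalar product $\langle x,y\rangle=-x_0y_0-x_1y_1+x_2y_2+x_3y_3+x_4y_4$ and the standard orientation, and let $\mathcal{E}^{1,2}=\{x_0^2+x_1^2=1,\ x_2^2+x_3^2+x_4^2=1\}$ be the $(1+2)$-Einstein universe, time-oriented by $-x_1\partial_{x_0}+x_0\partial_{x_1}$. All curves are smooth and defined on an open interval $I\subset\mathbb{R}$. For a future-directed timelike curve $\gamma:I\to\mathcal{E}^{1,2}$ let $\pi_{\mathcal N}$ be the orthogonal projection of $\mathbb{R}^{2,3}$ onto the orthogonal complement of $\mathrm{span}(\gamma,\gamma',\gamma'')$, and let $$\upsilon_\gamma=\sqrt[4]{\frac{\langle\pi_{\mathcal N}(\gamma'''),\pi_{\mathcal N}(\gamma''')\rangle}{|\langle\gamma',\gamma'\rangle|}}$$ be its strain density. The curve is generic if $\upsilon_\gamma$ vanishes nowhere, and it is parametrized by conformal parameter $u$ if $\upsilon_\gamma\equiv 1$. A Möbius basis is a positively oriented basis $(B_0,\dots,B_4)$ of $\mathbb{R}^{2,3}$ with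 $\langle B_0,B_4\rangle=\langle B_1,B_1\rangle=-1$, $\langle B_2,B_2\rangle=\langle B_3,B_3\rangle=1$, all other products of basis vectors being $0$, and such that $\det(B_0,B_1+B_2,e_2,e_3,e_4)>0$, where $e_0,\dots,e_4$ is the standard basis. The conformal curvatures of a generic future-directed timelike curve $\gamma$ are the smooth functions $k,h:I\to\mathbb{R}$ for which there is a smooth field $(M_0,\dots,M_4)$ of Möbius bases along $\gamma$ (the canonical conformal frame) such that $M_0$ is a positive multiple of $\gamma$ and $$M_0'=\upsilon_\gamma M_1,\quad M_1'=\upsilon_\gamma(-hM_0-M_4),\quad M_2'=\upsilon_\gamma(M_0+kM_3),\quad M_3'=-\upsilon_\gamma kM_2,\quad M_4'=\upsilon_\gamma(hM_1+M_2).$$ A compactly supported variation of $\gamma$ with support in a compact interval $K\subset I$ is a smooth map $\Gamma:I\times(-\epsilon,\epsilon)\to\mathcal{E}^{1,2}$, $\epsilon>0$, with $\Gamma(u,0)=\gamma(u)$ for all $u\in I$ and $\Gamma(u,t)=\gamma(u)$ for all $u\in I\setminus K$ and $|t|<\epsilon$; write $\gamma_{[t]}=\Gamma(\cdot,t)$.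 The curve $\gamma$ is critical for the conformal strain functional if $$\frac{d}{dt}\Big|_{t=0}\int_K\upsilon_{\gamma_{[t]}}(u)\,du=0$$ (the derivative existing) for every compact interval $K\subset I$ and every such variation with support in $K$. Theorem. Let $\gamma:I\to\mathcal{E}^{1,2}$ be a generic future-directed timelike curve parametrized by conformal parameter. Then $\gamma$ has conformal curvatures $k,h$, and $\gamma$ is critical for the conformal strain functional if and only if $$k''-k^3+2kh=0\quad\text{and}\quad h'-3kk'=0\quad\text{on } I.$$ -/

import Mathlib

open scoped ContDiff

noncomputable section

namespace EinsteinUniverse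

/-- The underlying space of `ℝ^{2,3}`, in the Cartesian coordinates `(x₀, …, x₄)` of the standard
Poincaré basis `(P₀, …, P₄)`; it is oriented by the determinant `dV` in these coordinates. -/
abbrev V : Type := Fin 5 → ℝ

/-- The scalar product `-x₀y₀ - x₁y₁ + x₂y₂ + x₃y₃ + x₄y₄` of `ℝ^{2,3}`. -/
def form : LinearMap.BilinForm ℝ V :=
  Matrix.toBilin' (Matrix.diagonal ![-1, -1, 1, 1, 1])

/-- The Einstein universe `S¹ × S²`, as a submanifold of `ℝ^{2,3}`. -/
def universe12 : Set V :=
  {X | X 0 ^ 2 + X 1 ^ 2 = 1 ∧ X 2 ^ 2 + X 3 ^ 2 + X 4 ^ 2 = 1}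

/-! ### Möbius bases -/

/-- The Gram matrix `-(E⁰₄ + E⁴₀) - E¹₁ + E²₂ + E³₃` of a Möbius basis. -/
def mobiusGram : Matrix (Fin 5) (Fin 5) ℝ :=
  !![ 0,  0, 0, 0, -1;
      0, -1, 0, 0,  0;
      0,  0, 1, 0,  0;
      0,  0, 0, 1,  0;
     -1,  0, 0, 0,  0]

/-- The isotropic bivector `X ∧ Y` is future directed: `dV(X, Y, P₂, P₃, P₄) > 0`, where
`P₂, P₃, P₄` is the oriented orthonormal basis of the reference spacelike `3`-space. -/
def IsFutureBivector (X Y : V) : Prop :=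
  0 < (Matrix.of ![X, Y, Pi.single 2 1, Pi.single 3 1, Pi.single 4 1]).det

/-- `(B₀, …, B₄)` is a Möbius basis: positively oriented, with Gram matrix `mobiusGram`, and with
the isotropic bivector `B₀ ∧ (B₁ + B₂)` future directed. -/
structure IsMobiusBasis (B : Fin 5 → V) : Prop where
  gram : ∀ i j, form (B i) (B j) = mobiusGram i j
  oriented : 0 < (Matrix.of B).det
  future : IsFutureBivector (B 0) (B 1 + B 2)

/-! ### Timelike curves and their strain density

A curve is a function `γ : ℝ → V` of which only the values on an open interval `I` matter. -/

/-- `γ` is a smooth future-directed timelike curve of the Einstein universe, defined on `I`. -/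
structure IsTimelikeCurve (γ : ℝ → V) (I : Set ℝ) : Prop where
  smooth : ContDiffOn ℝ ∞ γ I
  mem : ∀ u ∈ I, γ u ∈ universe12
  timelike : ∀ u ∈ I, form (deriv γ u) (deriv γ u) < 0
  /-- the time-component `η = (γ₀, γ₁)` satisfies `η' = ρ • jη` with `ρ > 0`, where `j` is the
  rotation by a right angle, `j (x₀, x₁) = (-x₁, x₀)` -/
  future : ∀ u ∈ I, ∃ ρ : ℝ, 0 < ρ ∧ deriv γ u 0 = ρ * -(γ u 1) ∧ deriv γ u 1 = ρ * γ u 0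

/-- The conformal osculating space at `γ u`, spanned by `γ`, `γ'`, `γ''`. -/
def osculatingSpace (γ : ℝ → V) (u : ℝ) : Submodule ℝ V :=
  Submodule.span ℝ {γ u, deriv γ u, iteratedDeriv 2 γ u}

/-- The normal conformal space, the orthogonal complement of the osculating space. -/
def normalSpace (γ : ℝ → V) (u : ℝ) : Submodule ℝ V :=
  form.orthogonal (osculatingSpace γ u)

open Classical in
/-- The orthogonal projection onto the normal space, i.e. the projection along the osculating
space. (For a timelike curve the two spaces are always complementary; otherwise the value is the
junk value `0`.) -/
def normalProj (γ : ℝ → V) (u : ℝ) : V →ₗ[ℝ] V :=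
  if hc : IsCompl (normalSpace γ u) (osculatingSpace γ u) then
    (normalSpace γ u).projection (osculatingSpace γ u) hc
  else 0

/-- The strain density `υ_γ`, the fourth root of
`⟨π_N γ''', π_N γ'''⟩ / |⟨γ', γ'⟩|`. -/
def strainDensity (γ : ℝ → V) (u : ℝ) : ℝ :=
  (form (normalProj γ u (iteratedDeriv 3 γ u)) (normalProj γ u (iteratedDeriv 3 γ u)) /
    |form (deriv γ u) (deriv γ u)|) ^ (1 / 4 : ℝ)

/-- `γ` has no conformal vertex. -/
def IsGeneric (γ : ℝ → V) (I : Set ℝ) : Prop :=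
  ∀ u ∈ I, strainDensity γ u ≠ 0

/-- `γ` is parametrized by conformal parameter: its infinitesimal strain is `du`. -/
def IsConformalParametrization (γ : ℝ → V) (I : Set ℝ) : Prop :=
  ∀ u ∈ I, strainDensity γ u = 1

/-! ### The canonical conformal frame and the conformal curvatures -/

/-- The coefficient matrix of the conformal Frenet equations. -/
def frenetMatrix (k h : ℝ) : Matrix (Fin 5) (Fin 5) ℝ :=
  !![0, -h, 1,  0, 0;
     1,  0, 0,  0, h;
     0,  0, 0, -k, 1;
     0,  0, k,  0, 0;
     0, -1, 0,  0, 0]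

/-- `M = (M₀, …, M₄)` is a canonical conformal frame along `γ`, with coefficients `k` and `h`:
a smooth map into the Möbius bases, with `M₀` a positive multiple of `γ`, and with
`dM_j = ∑ i, μ i j M_i` for `μ = frenetMatrix k h • υ_γ du`. -/
structure IsCanonicalFrame (γ : ℝ → V) (I : Set ℝ) (M : Fin 5 → ℝ → V) (k h : ℝ → ℝ) :
    Prop where
  smooth : ∀ j, ContDiffOn ℝ ∞ (M j) I
  smooth_k : ContDiffOn ℝ ∞ k I
  smooth_h : ContDiffOn ℝ ∞ h I
  mobius : ∀ u ∈ I, IsMobiusBasis fun j => M j u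
  lift : ∀ u ∈ I, ∃ r : ℝ, 0 < r ∧ M 0 u = r • γ u
  frenet : ∀ u ∈ I, ∀ j,
    HasDerivAt (M j) (strainDensity γ u • ∑ i, frenetMatrix (k u) (h u) i j • M i u) u

/-- `k` and `h` are the (first and second) conformal curvatures of `γ` on `I`. -/
def AreConformalCurvatures (γ : ℝ → V) (I : Set ℝ) (k h : ℝ → ℝ) : Prop :=
  ∃ M : Fin 5 → ℝ → V, IsCanonicalFrame γ I M k h

/-! ### The conformal strain functional -/

/-- The total strain of the arc `γ([a, b])`. -/
def totalStrain (γ : ℝ → V) (a b : ℝ) : ℝ :=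
  ∫ u in a..b, strainDensity γ u

/-- `Γ : I × (-ε, ε) → S¹ × S²` is a smooth variation of `γ`, compactly supported with support
contained in the compact interval `[a, b]`. The varied curves are `fun u => Γ u t`. -/
structure IsVariation (γ : ℝ → V) (I : Set ℝ) (a b ε : ℝ) (Γ : ℝ → ℝ → V) : Prop where
  smooth : ContDiffOn ℝ ∞ (fun p : ℝ × ℝ => Γ p.1 p.2) (I ×ˢ Set.Ioo (-ε) ε)
  mem : ∀ u ∈ I, ∀ t ∈ Set.Ioo (-ε) ε, Γ u t ∈ universe12
  zero : ∀ u ∈ I, Γ u 0 = γ u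
  support : ∀ u ∈ I, u ∉ Set.Icc a b → ∀ t ∈ Set.Ioo (-ε) ε, Γ u t = γ u

/-- `γ` is a critical curve of the conformal strain functional: for every compact interval
`[a, b] ⊆ I` and every variation supported in it, the total strain of `[a, b]` has derivative `0`
at `t = 0`. -/
def IsCriticalCurve (γ : ℝ → V) (I : Set ℝ) : Prop :=
  ∀ a b : ℝ, a ≤ b → Set.Icc a b ⊆ I → ∀ ε : ℝ, 0 < ε → ∀ Γ : ℝ → ℝ → V,
    IsVariation γ I a b ε Γ →
      HasDerivAt (fun t => totalStrain (fun u => Γ u t) a b) 0 0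

end EinsteinUniverse

end

/-!
# Critical curves of the conformal strain functional

A timelike curve `γ` of the Einstein universe is a curve of null rays in `ℝ^{2,3}`. It has exactly
one lift `X`, a positive multiple of `γ`, to the null cone such that `⟨X', X'⟩ = -1`
(`conformalLift`). Differentiating `⟨X, X⟩ = 0` and `⟨X', X'⟩ = -1` gives the scalar products of the
first three derivatives of `X` (`IsUnitJet`), and from them the formula
`υ_γ = (⟨X''', X'''⟩ + ⟨X'', X''⟩²)^(1/4)` for the strain density
(`strainDensity_eq_of_eqOn_smul`).

*Existence of the curvatures.* If `υ_γ = 1`, then `M₀ = X`, `M₁ = X'`, `M₂ = -N` for the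
component `N` of `X'''` orthogonal to `X`, `X'`, `X''`, `M₄ = -h X - X''` with
`h = -⟨X'', X''⟩ / 2`, and `M₃` the vector product of the other four, form a Möbius basis that
satisfies the Frenet equations with `k = ⟨M₂', M₃⟩`
(`exists_conformalCurvatures`). That the frame is future directed, and that the fourth power of the
strain density is never negative, both come from the Cauchy--Schwarz inequality for space components
(`mul_timeArea_sq_le`).

*First variation.* Let `Y` be the derivative at `t = 0` of the normalised lifts of a variation. Then
the total strain has the derivative `∫ (2⟨X''', Y'''⟩ + 4⟨X'', X''⟩⟨X'', Y''⟩) / 4`, because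
`υ_γ = 1` (`hasDerivAt_integral_rpow`). The constraints `⟨X, Y⟩ = 0` and `⟨X', Y'⟩ = 0`, with the
Frenet equations, turn the integrand into an exact derivative plus
`((h' - 3kk')⟨M₂, Y⟩ + (k'' - k³ + 2kh)⟨M₃, Y⟩) / 2`
(`IsCanonicalFrame.hasDerivAt_boundary`). The boundary term vanishes, since `Y` and its derivatives
vanish at the ends of the support (`IsCanonicalFrame.hasDerivAt_totalStrain`).

So the two equations imply that `γ` is critical. Conversely the components of `Y` along `M₂` and
`M₃` may be prescribed (`IsCanonicalFrame.normalVariation`): taking them to be the gradient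
`(h' - 3kk', k'' - k³ + 2kh)` times a bump function shows that this gradient is zero.
-/

noncomputable section

namespace EinsteinUniverse

/-! ### Calculus of smooth functions on open sets -/

section Calculus

variable {E : Type*} [NormedAddCommGroup E] [NormedSpace ℝ E]

lemma hasDerivAt_of_contDiffOn {J : Set ℝ} (hJ : IsOpen J) {f : ℝ → E}
    (hf : ContDiffOn ℝ ∞ f J) {u : ℝ} (hu : u ∈ J) : HasDerivAt f (deriv f u) u :=
  ((hf.contDiffAt (hJ.mem_nhds hu)).differentiableAt (by simp)).hasDerivAt

lemma contDiffOn_deriv {J : Set ℝ} (hJ : IsOpen J) {f : ℝ → E}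
    (hf : ContDiffOn ℝ ∞ f J) : ContDiffOn ℝ ∞ (deriv f) J :=
  ((contDiffOn_infty_iff_deriv_of_isOpen hJ).1 hf).2

/-- Two functions that agree on an open set have the same derivatives there. -/
lemma hasDerivAt_unique_of_eqOn {J : Set ℝ} (hJ : IsOpen J) {f g : ℝ → E} (h : Set.EqOn f g J)
    {u : ℝ} (hu : u ∈ J) {f' g' : E} (hf : HasDerivAt f f' u) (hg : HasDerivAt g g' u) :
    f' = g' :=
  hf.unique (hg.congr_of_eventuallyEq (h.eventuallyEq_of_mem (hJ.mem_nhds hu)))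

/-- The partial derivative in the first variable (the curve parameter). -/
def partialU (F : ℝ × ℝ → E) (p : ℝ × ℝ) : E := fderiv ℝ F p (1, 0)

/-- The partial derivative in the second variable (the variation parameter). -/
def partialT (F : ℝ × ℝ → E) (p : ℝ × ℝ) : E := fderiv ℝ F p (0, 1)

variable {U : Set (ℝ × ℝ)} {F G : ℝ × ℝ → E}

lemma contDiffOn_fderiv_apply (hU : IsOpen U) (hF : ContDiffOn ℝ ∞ F U) (w : ℝ × ℝ) :
    ContDiffOn ℝ ∞ (fun p => fderiv ℝ F p w) U :=
  ((contDiffOn_infty_iff_fderiv_of_isOpen hU).1 hF).2.clm_apply contDiffOn_const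

lemma contDiffOn_partialU (hU : IsOpen U) (hF : ContDiffOn ℝ ∞ F U) :
    ContDiffOn ℝ ∞ (partialU F) U := contDiffOn_fderiv_apply hU hF _

lemma contDiffOn_partialT (hU : IsOpen U) (hF : ContDiffOn ℝ ∞ F U) :
    ContDiffOn ℝ ∞ (partialT F) U := contDiffOn_fderiv_apply hU hF _

lemma hasFDerivAt_of_contDiffOn (hU : IsOpen U) (hF : ContDiffOn ℝ ∞ F U) {p : ℝ × ℝ}
    (hp : p ∈ U) : HasFDerivAt F (fderiv ℝ F p) p :=
  ((hF.contDiffAt (hU.mem_nhds hp)).differentiableAt (by simp)).hasFDerivAt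

lemma hasDerivAt_partialU (hU : IsOpen U) (hF : ContDiffOn ℝ ∞ F U) {u t : ℝ}
    (hp : (u, t) ∈ U) : HasDerivAt (fun u => F (u, t)) (partialU F (u, t)) u :=
  (hasFDerivAt_of_contDiffOn hU hF hp).comp_hasDerivAt u
    ((hasDerivAt_id u).prodMk (hasDerivAt_const u t))

lemma hasDerivAt_partialT (hU : IsOpen U) (hF : ContDiffOn ℝ ∞ F U) {u t : ℝ}
    (hp : (u, t) ∈ U) : HasDerivAt (fun t => F (u, t)) (partialT F (u, t)) t :=
  (hasFDerivAt_of_contDiffOn hU hF hp).comp_hasDerivAt t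
    ((hasDerivAt_const t u).prodMk (hasDerivAt_id t))

lemma partialT_partialU (hU : IsOpen U) (hF : ContDiffOn ℝ ∞ F U) :
    Set.EqOn (partialT (partialU F)) (partialU (partialT F)) U := by
  intro p hp
  have h2 : HasFDerivAt (fderiv ℝ F) (fderiv ℝ (fderiv ℝ F) p) p :=
    ((((contDiffOn_infty_iff_fderiv_of_isOpen hU).1 hF).2.contDiffAt
      (hU.mem_nhds hp)).differentiableAt (by simp)).hasFDerivAt
  have hs : IsSymmSndFDerivAt ℝ F p :=
    (hF.contDiffAt (hU.mem_nhds hp)).isSymmSndFDerivAt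
      (by simpa using (mod_cast le_top : ((2 : ℕ∞) : WithTop ℕ∞) ≤ ∞))
  have h3 (w : ℝ × ℝ) : fderiv ℝ (fun q => fderiv ℝ F q w) p
      = (fderiv ℝ (fderiv ℝ F) p).flip w := by
    have := (h2.clm_apply (hasFDerivAt_const w p)).fderiv
    simpa using this
  simp only [partialT, partialU]
  change fderiv ℝ (fun q => fderiv ℝ F q (1, 0)) p (0, 1)
    = fderiv ℝ (fun q => fderiv ℝ F q (0, 1)) p (1, 0)
  rw [h3, h3]
  exact hs _ _

lemma partialU_congr (hU : IsOpen U) (h : Set.EqOn F G U) :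
    Set.EqOn (partialU F) (partialU G) U := fun p hp => by
  simp only [partialU]
  rw [(h.eventuallyEq_of_mem (hU.mem_nhds hp)).fderiv_eq]

/-- Differentiation under the integral sign for an integrand that is smooth in both variables. -/
lemma hasDerivAt_intervalIntegral_of_contDiffOn (hU : IsOpen U) {f : ℝ × ℝ → ℝ}
    (hf : ContDiffOn ℝ ∞ f U) {a b : ℝ} (hab : a ≤ b) (hK : Set.Icc a b ×ˢ {(0 : ℝ)} ⊆ U) :
    HasDerivAt (fun t => ∫ u in a..b, f (u, t)) (∫ u in a..b, partialT f (u, 0)) 0 := by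
  obtain ⟨v, w, hv, hw, hav, h0w, hvw⟩ :=
    generalized_tube_lemma isCompact_Icc isCompact_singleton hU hK
  obtain ⟨δ, hδ, hδw⟩ := Metric.nhds_basis_closedBall.mem_iff.1 (hw.mem_nhds (h0w rfl))
  have hsub : Set.Icc a b ×ˢ Metric.closedBall (0 : ℝ) δ ⊆ U :=
    (Set.prod_mono hav hδw).trans hvw
  have hcT := (contDiffOn_partialT hU hf).continuousOn
  obtain ⟨C, hC⟩ := (isCompact_Icc.prod
    (isCompact_closedBall (0 : ℝ) δ)).exists_bound_of_continuousOn (hcT.mono hsub)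
  have hslice (g : ℝ × ℝ → ℝ) (hg : ContinuousOn g U) (t : ℝ)
      (ht : t ∈ Metric.closedBall (0 : ℝ) δ) :
      ContinuousOn (fun u => g (u, t)) (Set.uIcc a b) := by
    rw [Set.uIcc_of_le hab]
    exact hg.comp (by fun_prop) fun u hu => hsub ⟨hu, ht⟩
  have h0 : (0 : ℝ) ∈ Metric.closedBall (0 : ℝ) δ := Metric.mem_closedBall_self hδ.le
  refine (intervalIntegral.hasDerivAt_integral_of_dominated_loc_of_deriv_le
    (F := fun t u => f (u, t)) (F' := fun t u => partialT f (u, t)) (bound := fun _ => C)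
    (Metric.closedBall_mem_nhds 0 hδ) ?_ ?_ ?_ ?_ ?_ ?_).2
  · filter_upwards [Metric.closedBall_mem_nhds (0 : ℝ) hδ] with t ht
    exact ((hslice f hf.continuousOn t ht).intervalIntegrable).aestronglyMeasurable_restrict_uIoc
  · exact (hslice f hf.continuousOn 0 h0).intervalIntegrable
  · exact ((hslice _ hcT 0 h0).intervalIntegrable).aestronglyMeasurable_restrict_uIoc
  · refine Filter.Eventually.of_forall fun u hu t ht => hC (u, t) ⟨?_, ht⟩
    rw [Set.uIoc_of_le hab] at hu
    exact ⟨hu.1.le, hu.2⟩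
  · exact intervalIntegrable_const
  · refine Filter.Eventually.of_forall fun u hu t ht => ?_
    rw [Set.uIoc_of_le hab] at hu
    exact hasDerivAt_partialT hU hf (hsub ⟨⟨hu.1.le, hu.2⟩, ht⟩)

end Calculus

/-- A continuous function that vanishes off `[a, b]` vanishes at the end points of `[a, b]`. -/
lemma eq_zero_of_eqOn_compl_Icc {I : Set ℝ} (hI : IsOpen I) {a b : ℝ} (hab : a ≤ b)
    (hs : Set.Icc a b ⊆ I) {f : ℝ → V} (hf : ContinuousOn f I)
    (h0 : ∀ u ∈ I, u ∉ Set.Icc a b → f u = 0) : f a = 0 ∧ f b = 0 := by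
  have haI : a ∈ I := hs ⟨le_rfl, hab⟩
  have hbI : b ∈ I := hs ⟨hab, le_rfl⟩
  constructor
  · have h1 : Filter.Tendsto f (nhdsWithin a (Set.Iio a)) (nhds (f a)) :=
      (hf.continuousAt (hI.mem_nhds haI)).continuousWithinAt
    have h2 : f =ᶠ[nhdsWithin a (Set.Iio a)] fun _ => 0 := by
      filter_upwards [self_mem_nhdsWithin, nhdsWithin_le_nhds (hI.mem_nhds haI)] with x hx hxI
      exact h0 x hxI fun h => absurd h.1 (not_le.2 hx)
    exact tendsto_nhds_unique (h1.congr' h2) tendsto_const_nhds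
  · have h1 : Filter.Tendsto f (nhdsWithin b (Set.Ioi b)) (nhds (f b)) :=
      (hf.continuousAt (hI.mem_nhds hbI)).continuousWithinAt
    have h2 : f =ᶠ[nhdsWithin b (Set.Ioi b)] fun _ => 0 := by
      filter_upwards [self_mem_nhdsWithin, nhdsWithin_le_nhds (hI.mem_nhds hbI)] with x hx hxI
      exact h0 x hxI fun h => absurd h.2 (not_le.2 hx)
    exact tendsto_nhds_unique (h1.congr' h2) tendsto_const_nhds

/-! ### The scalar product -/

lemma form_apply (x y : V) :
    form x y = -(x 0 * y 0) - x 1 * y 1 + x 2 * y 2 + x 3 * y 3 + x 4 * y 4 := by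
  simp [form, Matrix.toBilin'_apply', Matrix.mulVec_diagonal, dotProduct, Fin.sum_univ_five]
  ring

lemma form_comm (x y : V) : form x y = form y x := by
  simp only [form_apply]; ring

/-- The Leibniz rule for the scalar product. -/
lemma hasDerivAt_form {f g : ℝ → V} {f' g' : V} {u : ℝ} (hf : HasDerivAt f f' u)
    (hg : HasDerivAt g g' u) :
    HasDerivAt (fun u => form (f u) (g u)) (form f' (g u) + form (f u) g') u := by
  have hf' := fun i => (hasDerivAt_pi.1 hf) i
  have hg' := fun i => (hasDerivAt_pi.1 hg) i
  simp only [form_apply]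
  refine (((((((hf' 0).mul (hg' 0)).neg).sub ((hf' 1).mul (hg' 1))).add
    ((hf' 2).mul (hg' 2))).add ((hf' 3).mul (hg' 3))).add ((hf' 4).mul (hg' 4))).congr_deriv ?_
  ring

lemma contDiffOn_form {E : Type*} [NormedAddCommGroup E] [NormedSpace ℝ E] {s : Set E}
    {f g : E → V} (hf : ContDiffOn ℝ ∞ f s) (hg : ContDiffOn ℝ ∞ g s) :
    ContDiffOn ℝ ∞ (fun p => form (f p) (g p)) s := by
  have hf' := fun i => (contDiffOn_pi.1 hf) i
  have hg' := fun i => (contDiffOn_pi.1 hg) i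
  simp only [form_apply]
  exact ((((((hf' 0).mul (hg' 0)).neg).sub ((hf' 1).mul (hg' 1))).add
    ((hf' 2).mul (hg' 2))).add ((hf' 3).mul (hg' 3))).add ((hf' 4).mul (hg' 4))

/-! ### Null vectors and the signature of the scalar product -/

section Causality

variable {X Y Q : V}

lemma cauchySchwarz_three (a b c x y z : ℝ) : (a * x + b * y + c * z) ^ 2 ≤
    (a ^ 2 + b ^ 2 + c ^ 2) * (x ^ 2 + y ^ 2 + z ^ 2) := by
  have h : (a ^ 2 + b ^ 2 + c ^ 2) * (x ^ 2 + y ^ 2 + z ^ 2) - (a * x + b * y + c * z) ^ 2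
      = (a * y - b * x) ^ 2 + (a * z - c * x) ^ 2 + (b * z - c * y) ^ 2 := by ring
  have : 0 ≤ (a * y - b * x) ^ 2 + (a * z - c * x) ^ 2 + (b * z - c * y) ^ 2 := by positivity
  linarith

/-- The area spanned by the time components of `X` and `Y`. It decides whether `Y` points to the
future of the null vector `X`. -/
def timeArea (X Y : V) : ℝ := X 0 * Y 1 - X 1 * Y 0

/-- On the orthogonal complement of a null vector `X`, the scalar product is a Lorentzian form
modulo `X`: subtracting a multiple of `X`, a vector `Y` may be given a time component that is
orthogonal to that of `X`, and then its space component is orthogonal to that of `X` too. This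
is the Cauchy--Schwarz inequality for the space components of two such vectors `Y`, `Q`; the
factor `s = |(X₀, X₁)|²` clears denominators. -/
lemma timeArea_sq_mul_le (hX : form X X = 0) (hXY : form X Y = 0) (hXQ : form X Q = 0)
    (hYQ : form Y Q = 0) {s : ℝ} (hs : s = X 0 ^ 2 + X 1 ^ 2) (hs0 : 0 < s) :
    (timeArea X Y) ^ 2 * (timeArea X Q) ^ 2 ≤
      (s * form Y Y + timeArea X Y ^ 2) * (s * form Q Q + timeArea X Q ^ 2) := by
  obtain ⟨c, hcs⟩ : ∃ c, c * s = X 0 * Y 0 + X 1 * Y 1 := ⟨_, div_mul_cancel₀ _ hs0.ne'⟩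
  obtain ⟨d, hds⟩ : ∃ d, d * s = X 0 * Q 0 + X 1 * Q 1 := ⟨_, div_mul_cancel₀ _ hs0.ne'⟩
  rw [form_apply] at hX hXY hXQ hYQ
  rw [form_apply Y, form_apply Q]
  have hX' : X 2 ^ 2 + X 3 ^ 2 + X 4 ^ 2 = s := by rw [hs]; linarith
  have hXY' : X 2 * Y 2 + X 3 * Y 3 + X 4 * Y 4 = c * s := by rw [hcs]; linarith
  have hXQ' : X 2 * Q 2 + X 3 * Q 3 + X 4 * Q 4 = d * s := by rw [hds]; linarith
  have hY2 : s * (Y 0 ^ 2 + Y 1 ^ 2) = timeArea X Y ^ 2 + (c * s) ^ 2 := by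
    rw [hcs, hs]; simp only [timeArea]; ring
  have hQ2 : s * (Q 0 ^ 2 + Q 1 ^ 2) = timeArea X Q ^ 2 + (d * s) ^ 2 := by
    rw [hds, hs]; simp only [timeArea]; ring
  have hYQ2 : s * (Y 0 * Q 0 + Y 1 * Q 1) = timeArea X Y * timeArea X Q + (c * s) * (d * s) := by
    rw [hcs, hds, hs]; simp only [timeArea]; ring
  have hYY : s * (-(Y 0 * Y 0) - Y 1 * Y 1 + Y 2 * Y 2 + Y 3 * Y 3 + Y 4 * Y 4)
      + timeArea X Y ^ 2
      = s * ((Y 2 - c * X 2) ^ 2 + (Y 3 - c * X 3) ^ 2 + (Y 4 - c * X 4) ^ 2) := by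
    linear_combination (-1) * hY2 + 2 * c * s * hXY' - c ^ 2 * s * hX'
  have hQQ : s * (-(Q 0 * Q 0) - Q 1 * Q 1 + Q 2 * Q 2 + Q 3 * Q 3 + Q 4 * Q 4)
      + timeArea X Q ^ 2
      = s * ((Q 2 - d * X 2) ^ 2 + (Q 3 - d * X 3) ^ 2 + (Q 4 - d * X 4) ^ 2) := by
    linear_combination (-1) * hQ2 + 2 * d * s * hXQ' - d ^ 2 * s * hX'
  have hYQ' : timeArea X Y * timeArea X Q
      = s * ((Y 2 - c * X 2) * (Q 2 - d * X 2) + (Y 3 - c * X 3) * (Q 3 - d * X 3)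
        + (Y 4 - c * X 4) * (Q 4 - d * X 4)) := by
    linear_combination (-1) * hYQ2 - s * hYQ + d * s * hXY' + c * s * hXQ' - c * d * s * hX'
  rw [hYY, hQQ, ← mul_pow, hYQ', mul_pow]
  rw [show ∀ x y : ℝ, s * x * (s * y) = s ^ 2 * (x * y) from fun x y => by ring]
  exact mul_le_mul_of_nonneg_left (cauchySchwarz_three ..) (sq_nonneg s)

/-- The space component of a vector orthogonal to the null vector `X` is at least as long as its
part along `X`. -/
lemma form_self_add_timeArea_sq_nonneg (hX : form X X = 0) (hXY : form X Y = 0) {s : ℝ}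
    (hs : s = X 0 ^ 2 + X 1 ^ 2) : 0 ≤ s * form Y Y + timeArea X Y ^ 2 := by
  simp only [form_apply, timeArea] at *
  have hX' : X 2 ^ 2 + X 3 ^ 2 + X 4 ^ 2 = s := by rw [hs]; linarith
  have hXY' : X 2 * Y 2 + X 3 * Y 3 + X 4 * Y 4 = X 0 * Y 0 + X 1 * Y 1 := by linarith
  have h1 : s * (Y 0 ^ 2 + Y 1 ^ 2)
      = (X 0 * Y 1 - X 1 * Y 0) ^ 2 + (X 0 * Y 0 + X 1 * Y 1) ^ 2 := by
    rw [hs]; ring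
  have h2 : (X 0 * Y 0 + X 1 * Y 1) ^ 2 ≤ s * (Y 2 ^ 2 + Y 3 ^ 2 + Y 4 ^ 2) := by
    rw [← hXY', ← hX']
    exact cauchySchwarz_three ..
  nlinarith

/-- The inequality `q² ≤ ⟨Q, Q⟩ (p² - 1)` for `p`, `q` the time areas of `Y`, `Q` divided by `√s`.
Since `p² ≥ 1`, it bounds `⟨Q, Q⟩` from below, and it gives `|q| < p` for a unit vector `Q`. -/
lemma mul_timeArea_sq_le (hX : form X X = 0) (hXY : form X Y = 0) (hXQ : form X Q = 0)
    (hYQ : form Y Q = 0) (hYY : form Y Y = -1) {s : ℝ} (hs : s = X 0 ^ 2 + X 1 ^ 2) (hs0 : 0 < s) :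
    timeArea X Q ^ 2 ≤ form Q Q * (timeArea X Y ^ 2 - s) := by
  have h := timeArea_sq_mul_le hX hXY hXQ hYQ hs hs0
  rw [hYY] at h
  refine le_of_mul_le_mul_left ?_ hs0
  linarith

lemma le_timeArea_sq (hX : form X X = 0) (hXY : form X Y = 0) (hYY : form Y Y = -1) {s : ℝ}
    (hs : s = X 0 ^ 2 + X 1 ^ 2) : s ≤ timeArea X Y ^ 2 := by
  have h := form_self_add_timeArea_sq_nonneg hX hXY hs
  rw [hYY] at h; linarith

/-- The scalar product is positive semidefinite on the complement of a null vector `X` and a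
timelike vector `Y`. -/
lemma form_self_nonneg (hX : form X X = 0) (hXY : form X Y = 0) (hXQ : form X Q = 0)
    (hYQ : form Y Q = 0) (hYY : form Y Y = -1) (hs0 : 0 < X 0 ^ 2 + X 1 ^ 2) : 0 ≤ form Q Q := by
  have h := mul_timeArea_sq_le hX hXY hXQ hYQ hYY rfl hs0
  have h1 := le_timeArea_sq hX hXY hYY rfl
  have h2 := form_self_add_timeArea_sq_nonneg hX hXQ rfl
  by_contra hneg
  push Not at hneg
  nlinarith [mul_pos hs0 (neg_pos.2 hneg), mul_nonneg (neg_pos.2 hneg).le (sub_nonneg.2 h1)]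

/-- The degenerate directions of that complement are the multiples of `X`. -/
lemma eq_smul_of_form_self_eq_zero (hX : form X X = 0) (hXY : form X Y = 0) (hXQ : form X Q = 0)
    (hYQ : form Y Q = 0) (hYY : form Y Y = -1) (hs0 : 0 < X 0 ^ 2 + X 1 ^ 2)
    (hQ : form Q Q = 0) : ∃ c : ℝ, Q = c • X := by
  have h := mul_timeArea_sq_le hX hXY hXQ hYQ hYY rfl hs0
  rw [hQ, zero_mul] at h
  have hA : timeArea X Q = 0 := by nlinarith
  obtain ⟨s, hs⟩ : ∃ s, s = X 0 ^ 2 + X 1 ^ 2 := ⟨_, rfl⟩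
  rw [← hs] at hs0
  have hA' : X 0 * Q 1 = X 1 * Q 0 := by simp only [timeArea] at hA; linarith
  obtain ⟨d, hds⟩ : ∃ d, d * s = X 0 * Q 0 + X 1 * Q 1 := ⟨_, div_mul_cancel₀ _ hs0.ne'⟩
  have hQ0 : Q 0 = d * X 0 := by
    refine mul_left_cancel₀ hs0.ne' ?_
    linear_combination Q 0 * hs - X 0 * hds - X 1 * hA'
  have hQ1 : Q 1 = d * X 1 := by
    refine mul_left_cancel₀ hs0.ne' ?_
    linear_combination Q 1 * hs - X 1 * hds + X 0 * hA'
  rw [form_apply] at hX hXQ hQ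
  have hsum : (Q 2 - d * X 2) ^ 2 + (Q 3 - d * X 3) ^ 2 + (Q 4 - d * X 4) ^ 2 = 0 := by
    rw [hQ0, hQ1] at hQ hXQ
    linear_combination hQ + d ^ 2 * hX - 2 * d * hXQ
  have h2 := sq_nonneg (Q 2 - d * X 2)
  have h3 := sq_nonneg (Q 3 - d * X 3)
  have h4 := sq_nonneg (Q 4 - d * X 4)
  have h2' : Q 2 - d * X 2 = 0 := pow_eq_zero_iff two_ne_zero |>.1 (by linarith)
  have h3' : Q 3 - d * X 3 = 0 := pow_eq_zero_iff two_ne_zero |>.1 (by linarith)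
  have h4' : Q 4 - d * X 4 = 0 := pow_eq_zero_iff two_ne_zero |>.1 (by linarith)
  refine ⟨d, funext fun i => ?_⟩
  fin_cases i
  exacts [hQ0, hQ1, sub_eq_zero.1 h2', sub_eq_zero.1 h3', sub_eq_zero.1 h4']

/-- If the timelike vector `Y` points to the future and `Q` is a unit spacelike vector, then
`Y + Q` points to the future. -/
lemma timeArea_add_pos (hX : form X X = 0) (hXY : form X Y = 0) (hXQ : form X Q = 0)
    (hYQ : form Y Q = 0) (hYY : form Y Y = -1) (hs0 : 0 < X 0 ^ 2 + X 1 ^ 2)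
    (hQ : form Q Q = 1) (hY : 0 < timeArea X Y) : 0 < timeArea X (Y + Q) := by
  have h := mul_timeArea_sq_le hX hXY hXQ hYQ hYY rfl hs0
  rw [hQ, one_mul] at h
  have : timeArea X (Y + Q) = timeArea X Y + timeArea X Q := by simp [timeArea]; ring
  rw [this]
  nlinarith

lemma isFutureBivector_iff (X Y : V) : IsFutureBivector X Y ↔ 0 < timeArea X Y := by
  have : (Matrix.of ![X, Y, Pi.single 2 1, Pi.single 3 1, Pi.single 4 1]).det = timeArea X Y := by
    simp [Matrix.det_succ_row_zero, Fin.sum_univ_succ, timeArea, Fin.succAbove, Pi.single_apply]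
    ring
  rw [IsFutureBivector, this]

lemma sq_add_sq_pos_of_null (hX : form X X = 0) (h0 : X ≠ 0) : 0 < X 0 ^ 2 + X 1 ^ 2 := by
  by_contra h
  apply h0
  rw [form_apply] at hX
  have h' : ∀ i, X i = 0 := by
    intro i
    have : X i ^ 2 ≤ 0 := by
      fin_cases i <;> simp <;> nlinarith [sq_nonneg (X 0), sq_nonneg (X 1), sq_nonneg (X 2),
        sq_nonneg (X 3), sq_nonneg (X 4)]
    nlinarith
  exact funext h'

end Causality

/-! ### The strain density of a null curve with unit timelike derivative -/

/-- The relations between the scalar products of a null vector function with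
`⟨X', X'⟩ = -1` and its derivatives `X₁`, `X₂`, `X₃` of order at most three, at one point. -/
structure IsUnitJet (X X₁ X₂ X₃ : V) : Prop where
  r00 : form X X = 0
  r01 : form X X₁ = 0
  r11 : form X₁ X₁ = -1
  r02 : form X X₂ = 1
  r12 : form X₁ X₂ = 0
  r03 : form X X₃ = 0
  r13 : form X₁ X₃ = -form X₂ X₂

/-- The component of `X'''` orthogonal to `X`, `X'`, `X''`. -/
def jetNormal (X X₁ X₂ X₃ : V) : V := X₃ - form X₂ X₂ • X₁ - form X₃ X₂ • X

section Jet

variable {X X₁ X₂ X₃ : V}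

namespace IsUnitJet

lemma form_normal_zero (h : IsUnitJet X X₁ X₂ X₃) : form X (jetNormal X X₁ X₂ X₃) = 0 := by
  simp [jetNormal, h.r00, h.r01, h.r03]

lemma form_normal_one (h : IsUnitJet X X₁ X₂ X₃) : form X₁ (jetNormal X X₁ X₂ X₃) = 0 := by
  simp [jetNormal, form_comm X₁ X, h.r01, h.r11, h.r13]

lemma form_normal_two (h : IsUnitJet X X₁ X₂ X₃) : form X₂ (jetNormal X X₁ X₂ X₃) = 0 := by
  simp [jetNormal, form_comm X₂ X, form_comm X₂ X₁, h.r02, h.r12, form_comm X₃ X₂]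

lemma form_normal_self (h : IsUnitJet X X₁ X₂ X₃) :
    form (jetNormal X X₁ X₂ X₃) (jetNormal X X₁ X₂ X₃) = form X₃ X₃ + form X₂ X₂ ^ 2 := by
  have h1 := h.form_normal_zero
  have h2 := h.form_normal_one
  have : jetNormal X X₁ X₂ X₃ = X₃ - form X₂ X₂ • X₁ - form X₃ X₂ • X := rfl
  conv_lhs => lhs; rw [this]
  simp only [map_sub, map_smul, LinearMap.sub_apply, LinearMap.smul_apply, h1, h2, smul_zero,
    sub_zero]
  rw [this]
  simp [form_comm X₃ X, form_comm X₃ X₁, h.r03, h.r13]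
  ring

lemma ne_zero (h : IsUnitJet X X₁ X₂ X₃) : X ≠ 0 := by
  rintro rfl
  simpa using h.r02

lemma strain_nonneg (h : IsUnitJet X X₁ X₂ X₃) : 0 ≤ form X₃ X₃ + form X₂ X₂ ^ 2 := by
  rw [← h.form_normal_self]
  exact form_self_nonneg h.r00 h.r01 h.form_normal_zero h.form_normal_one h.r11
    (sq_add_sq_pos_of_null h.r00 h.ne_zero)

end IsUnitJet

/-- The strain density in terms of the normalised lift `X` of the curve, `γ = f • X`. -/
lemma strainDensity_eq_of_isUnitJet (h : IsUnitJet X X₁ X₂ X₃) {γ : ℝ → V} {u f f₁ f₂ f₃ : ℝ}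
    (hf : 0 < f) (e0 : γ u = f • X) (e1 : deriv γ u = f₁ • X + f • X₁)
    (e2 : iteratedDeriv 2 γ u = f₂ • X + (2 * f₁) • X₁ + f • X₂)
    (e3 : iteratedDeriv 3 γ u = f₃ • X + (3 * f₂) • X₁ + (3 * f₁) • X₂ + f • X₃) :
    strainDensity γ u = (form X₃ X₃ + form X₂ X₂ ^ 2) ^ (1 / 4 : ℝ) := by
  have m0 : X ∈ osculatingSpace γ u := by
    have : γ u ∈ osculatingSpace γ u := Submodule.subset_span (by simp)
    rwa [e0, Submodule.smul_mem_iff _ hf.ne'] at this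
  have m1 : X₁ ∈ osculatingSpace γ u := by
    have : deriv γ u ∈ osculatingSpace γ u := Submodule.subset_span (by simp)
    rwa [e1, Submodule.add_mem_iff_right _ (Submodule.smul_mem _ _ m0),
      Submodule.smul_mem_iff _ hf.ne'] at this
  have m2 : X₂ ∈ osculatingSpace γ u := by
    have : iteratedDeriv 2 γ u ∈ osculatingSpace γ u := Submodule.subset_span (by simp)
    rwa [e2, Submodule.add_mem_iff_right _ (Submodule.add_mem _ (Submodule.smul_mem _ _ m0)
      (Submodule.smul_mem _ _ m1)), Submodule.smul_mem_iff _ hf.ne'] at this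
  have hspan : osculatingSpace γ u = Submodule.span ℝ {X, X₁, X₂} := by
    apply le_antisymm
    · have x0 : X ∈ Submodule.span ℝ {X, X₁, X₂} := Submodule.subset_span (by simp)
      have x1 : X₁ ∈ Submodule.span ℝ {X, X₁, X₂} := Submodule.subset_span (by simp)
      have x2 : X₂ ∈ Submodule.span ℝ {X, X₁, X₂} := Submodule.subset_span (by simp)
      refine Submodule.span_le.2 ?_
      rintro _ (rfl | rfl | rfl)
      · rw [e0]; exact Submodule.smul_mem _ _ x0
      · rw [e1]; exact Submodule.add_mem _ (Submodule.smul_mem _ _ x0) (Submodule.smul_mem _ _ x1)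
      · rw [e2]
        exact Submodule.add_mem _ (Submodule.add_mem _ (Submodule.smul_mem _ _ x0)
          (Submodule.smul_mem _ _ x1)) (Submodule.smul_mem _ _ x2)
    · refine Submodule.span_le.2 ?_
      rintro _ (rfl | rfl | rfl)
      exacts [m0, m1, m2]
  have hnormal (z : V) : z ∈ normalSpace γ u ↔ form X z = 0 ∧ form X₁ z = 0 ∧ form X₂ z = 0 := by
    rw [normalSpace, LinearMap.BilinForm.mem_orthogonal_iff]
    constructor
    · exact fun hz => ⟨hz _ m0, hz _ m1, hz _ m2⟩
    · rintro ⟨z0, z1, z2⟩ n hn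
      rw [hspan, Submodule.mem_span_triple] at hn
      obtain ⟨a, b, c, rfl⟩ := hn
      simp [z0, z1, z2]
  have hN : jetNormal X X₁ X₂ X₃ ∈ normalSpace γ u :=
    (hnormal _).2 ⟨h.form_normal_zero, h.form_normal_one, h.form_normal_two⟩
  have hcompl : IsCompl (normalSpace γ u) (osculatingSpace γ u) := by
    constructor
    · rw [Submodule.disjoint_def]
      intro z hz hz'
      rw [hspan, Submodule.mem_span_triple] at hz'
      obtain ⟨a, b, c, rfl⟩ := hz'
      obtain ⟨z0, z1, z2⟩ := (hnormal _).1 hz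
      have hc : c = 0 := by simpa [h.r00, h.r01, h.r02] using z0
      have hb : b = 0 := by simpa [form_comm X₁ X, h.r01, h.r11, h.r12] using z1
      have ha : a = 0 := by
        simpa [form_comm X₂ X, form_comm X₂ X₁, h.r02, h.r12, hc, hb] using z2
      simp [ha, hb, hc]
    · rw [codisjoint_iff, Submodule.eq_top_iff']
      intro z
      rw [Submodule.mem_sup]
      obtain ⟨w, hw⟩ : ∃ w, w = (form X₂ z - form X₂ X₂ * form X z) • X + (-form X₁ z) • X₁
        + form X z • X₂ := ⟨_, rfl⟩
      refine ⟨z - w, (hnormal _).2 ⟨?_, ?_, ?_⟩, w, ?_, sub_add_cancel _ _⟩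
      · simp [hw, h.r00, h.r01, h.r02]
      · simp [hw, form_comm X₁ X, h.r01, h.r11, h.r12]
      · simp [hw, form_comm X₂ X, form_comm X₂ X₁, h.r02, h.r12]
        ring
      · rw [hw]
        exact Submodule.add_mem _ (Submodule.add_mem _ (Submodule.smul_mem _ _ m0)
          (Submodule.smul_mem _ _ m1)) (Submodule.smul_mem _ _ m2)
  have hproj : normalProj γ u (iteratedDeriv 3 γ u) = f • jetNormal X X₁ X₂ X₃ := by
    rw [normalProj, dif_pos hcompl]
    have hdec : iteratedDeriv 3 γ u = f • jetNormal X X₁ X₂ X₃ + ((f₃ + f * form X₃ X₂) • X +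
        (3 * f₂ + f * form X₂ X₂) • X₁ + (3 * f₁) • X₂) := by
      rw [e3, jetNormal]; module
    rw [hdec, map_add, map_smul, Submodule.projection_apply_of_mem_left _ hN,
      Submodule.projection_apply_of_mem_right _ (Submodule.add_mem _ (Submodule.add_mem _
        (Submodule.smul_mem _ _ m0) (Submodule.smul_mem _ _ m1)) (Submodule.smul_mem _ _ m2)),
      add_zero]
  have hden : |form (deriv γ u) (deriv γ u)| = f * f := by
    rw [e1]
    simp [h.r00, h.r01, form_comm X₁ X, h.r11]
  rw [strainDensity, hproj, hden, ← h.form_normal_self]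
  congr 1
  simp only [map_smul, LinearMap.smul_apply, smul_eq_mul]
  field_simp

end Jet

section Curve

variable {J : Set ℝ} {X X₁ X₂ X₃ : ℝ → V}

/-- Differentiating `⟨X, X⟩ = 0` and `⟨X', X'⟩ = -1`. -/
lemma isUnitJet_of_hasDerivAt (hJ : IsOpen J) (h1 : ∀ u ∈ J, HasDerivAt X (X₁ u) u)
    (h2 : ∀ u ∈ J, HasDerivAt X₁ (X₂ u) u) (h3 : ∀ u ∈ J, HasDerivAt X₂ (X₃ u) u)
    (hnull : ∀ u ∈ J, form (X u) (X u) = 0) (hunit : ∀ u ∈ J, form (X₁ u) (X₁ u) = -1) {u : ℝ}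
    (hu : u ∈ J) : IsUnitJet (X u) (X₁ u) (X₂ u) (X₃ u) := by
  have r01 : ∀ u ∈ J, form (X u) (X₁ u) = 0 := fun u hu => by
    have := hasDerivAt_unique_of_eqOn hJ hnull hu
      (hasDerivAt_form (h1 u hu) (h1 u hu)) (hasDerivAt_const u 0)
    rw [form_comm (X₁ u)] at this; linarith
  have r02 : ∀ u ∈ J, form (X u) (X₂ u) = 1 := fun u hu => by
    have := hasDerivAt_unique_of_eqOn hJ r01 hu
      (hasDerivAt_form (h1 u hu) (h2 u hu)) (hasDerivAt_const u 0)
    rw [hunit u hu] at this; linarith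
  have r12 : ∀ u ∈ J, form (X₁ u) (X₂ u) = 0 := fun u hu => by
    have := hasDerivAt_unique_of_eqOn hJ hunit hu (hasDerivAt_form (h2 u hu) (h2 u hu))
      (hasDerivAt_const u (-1))
    rw [form_comm (X₂ u)] at this; linarith
  refine ⟨hnull u hu, r01 u hu, hunit u hu, r02 u hu, r12 u hu, ?_, ?_⟩
  · have := hasDerivAt_unique_of_eqOn hJ r02 hu
      (hasDerivAt_form (h1 u hu) (h3 u hu)) (hasDerivAt_const u 1)
    rw [r12 u hu] at this; linarith
  · have := hasDerivAt_unique_of_eqOn hJ r12 hu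
      (hasDerivAt_form (h2 u hu) (h3 u hu)) (hasDerivAt_const u 0)
    linarith

/-- The fourth power of the strain density is a polynomial in the derivatives of the normalised
lift. This makes its smoothness, and its dependence on parameters, visible. -/
lemma strainDensity_eq_of_eqOn_smul (hJ : IsOpen J) (h1 : ∀ u ∈ J, HasDerivAt X (X₁ u) u)
    (h2 : ∀ u ∈ J, HasDerivAt X₁ (X₂ u) u) (h3 : ∀ u ∈ J, HasDerivAt X₂ (X₃ u) u)
    (hnull : ∀ u ∈ J, form (X u) (X u) = 0) (hunit : ∀ u ∈ J, form (X₁ u) (X₁ u) = -1)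
    {γ : ℝ → V} {f : ℝ → ℝ} (hf : ContDiffOn ℝ ∞ f J) (hf0 : ∀ u ∈ J, 0 < f u)
    (hγ : ∀ u ∈ J, γ u = f u • X u) {u : ℝ} (hu : u ∈ J) :
    strainDensity γ u = (form (X₃ u) (X₃ u) + form (X₂ u) (X₂ u) ^ 2) ^ (1 / 4 : ℝ) := by
  have hf1 := contDiffOn_deriv hJ hf
  have hf2 := contDiffOn_deriv hJ hf1
  have d0 := fun v hv => hasDerivAt_of_contDiffOn hJ hf (u := v) hv
  have d1 := fun v hv => hasDerivAt_of_contDiffOn hJ hf1 (u := v) hv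
  have d2 := fun v hv => hasDerivAt_of_contDiffOn hJ hf2 (u := v) hv
  have e1 : ∀ v ∈ J, deriv γ v = deriv f v • X v + f v • X₁ v := fun v hv => by
    rw [((show Set.EqOn γ _ J from hγ).eventuallyEq_of_mem (hJ.mem_nhds hv)).deriv_eq]
    exact ((d0 v hv).smul (h1 v hv)).deriv.trans (add_comm _ _)
  have e2 : ∀ v ∈ J, deriv (deriv γ) v
      = deriv (deriv f) v • X v + (2 * deriv f v) • X₁ v + f v • X₂ v := fun v hv => by
    rw [((show Set.EqOn (deriv γ) _ J from e1).eventuallyEq_of_mem (hJ.mem_nhds hv)).deriv_eq]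
    refine (((d1 v hv).smul (h1 v hv)).add ((d0 v hv).smul (h2 v hv))).deriv.trans ?_
    module
  have e3 : ∀ v ∈ J, deriv (deriv (deriv γ)) v
      = deriv (deriv (deriv f)) v • X v + (3 * deriv (deriv f) v) • X₁ v
        + (3 * deriv f v) • X₂ v + f v • X₃ v := fun v hv => by
    rw [((show Set.EqOn (deriv (deriv γ)) _ J from e2).eventuallyEq_of_mem
      (hJ.mem_nhds hv)).deriv_eq]
    refine ((((d2 v hv).smul (h1 v hv)).add (((d1 v hv).const_mul 2).smul (h2 v hv))).add
      ((d0 v hv).smul (h3 v hv))).deriv.trans ?_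
    module
  refine strainDensity_eq_of_isUnitJet (isUnitJet_of_hasDerivAt hJ h1 h2 h3 hnull hunit hu)
    (hf0 u hu) (hγ u hu) (e1 u hu) ?_ ?_ (f₂ := deriv (deriv f) u)
    (f₃ := deriv (deriv (deriv f)) u)
  · simpa [iteratedDeriv_succ, iteratedDeriv_zero] using e2 u hu
  · simpa [iteratedDeriv_succ, iteratedDeriv_zero] using e3 u hu

end Curve

lemma form_self_eq_zero_of_mem {x : V} (hx : x ∈ universe12) : form x x = 0 := by
  obtain ⟨h1, h2⟩ := hx
  rw [form_apply]; linarith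

/-- The Lorentzian length `√(-⟨w, w⟩)` of a timelike vector `w`. -/
def speed (w : V) : ℝ := √(-form w w)

lemma speed_pos {w : V} (hw : form w w < 0) : 0 < speed w := Real.sqrt_pos.2 (by linarith)

lemma speed_sq {w : V} (hw : form w w < 0) : speed w ^ 2 = -form w w :=
  Real.sq_sqrt (by linarith)

/-- Dividing a null curve by its speed makes the derivative a unit timelike vector. -/
lemma form_deriv_normalized {x w : V} {g' : ℝ} (hx : form x x = 0) (hxw : form x w = 0)
    (hw : form w w < 0) :
    form (g' • x + (speed w)⁻¹ • w) (g' • x + (speed w)⁻¹ • w) = -1 := by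
  have := speed_pos hw
  have h2 := speed_sq hw
  simp [hx, hxw, form_comm w x]
  field_simp
  linarith

/-! ### Möbius bases -/

lemma form_gram (B : Fin 5 → V) : Matrix.of (fun i j => form (B i) (B j))
    = Matrix.of B * Matrix.diagonal ![-1, -1, 1, 1, 1] * (Matrix.of B).transpose := by
  ext i j
  simp [form_apply, Matrix.mul_apply, Fin.sum_univ_five, sub_eq_add_neg]

lemma det_gram (B : Fin 5 → V) :
    (Matrix.of (fun i j => form (B i) (B j))).det = (Matrix.of B).det ^ 2 := by
  rw [form_gram, Matrix.det_mul, Matrix.det_mul, Matrix.det_transpose, Matrix.det_diagonal]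
  simp [Fin.prod_univ_five]
  ring

/-- The scalar product is nondegenerate: a vector is determined by its products with a basis. -/
lemma eq_of_form_eq {B : Fin 5 → V} (hB : (Matrix.of B).det ≠ 0) {Z W : V}
    (h : ∀ j, form (B j) Z = form (B j) W) : Z = W := by
  have h1 : (Matrix.diagonal ![-1, -1, 1, 1, 1]).mulVec (Z - W) = 0 := by
    refine Matrix.eq_zero_of_mulVec_eq_zero hB (funext fun j => ?_)
    have := h j
    simp only [form_apply] at this
    simp [Matrix.mulVec, dotProduct, Fin.sum_univ_five, Matrix.diagonal]
    linarith
  have h2 : Z - W = 0 := by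
    refine Matrix.eq_zero_of_mulVec_eq_zero ?_ h1
    rw [Matrix.det_diagonal]
    simp [Fin.prod_univ_five]
  exact sub_eq_zero.1 h2

/-- The vector product of four vectors, `⟨A × B × C × D, Z⟩ = dV(A, B, C, Z, D)`. -/
def cross (A B C D : V) : V := fun j =>
  ![-1, -1, 1, 1, 1] j *
    ((-1) ^ (3 + j : ℕ) * ((Matrix.of ![A, B, C, D]).submatrix id j.succAbove).det)

lemma form_cross (A B C D Z : V) :
    form (cross A B C D) Z = (Matrix.of ![A, B, C, Z, D]).det := by
  have hsub (j : Fin 5) : (Matrix.of ![A, B, C, Z, D]).submatrix (Fin.succAbove 3) j.succAbove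
      = (Matrix.of ![A, B, C, D]).submatrix id j.succAbove := by
    ext i k
    fin_cases i <;> rfl
  rw [Matrix.det_succ_row _ 3, form_apply, Fin.sum_univ_five]
  simp only [hsub]
  simp only [cross]
  simp
  ring

lemma form_cross_zero (A B C D : V) : form (cross A B C D) A = 0 := by
  rw [form_cross]
  exact Matrix.det_zero_of_row_eq (i := 0) (j := 3) (by decide) rfl

lemma form_cross_one (A B C D : V) : form (cross A B C D) B = 0 := by
  rw [form_cross]
  exact Matrix.det_zero_of_row_eq (i := 1) (j := 3) (by decide) rfl

lemma form_cross_two (A B C D : V) : form (cross A B C D) C = 0 := by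
  rw [form_cross]
  exact Matrix.det_zero_of_row_eq (i := 2) (j := 3) (by decide) rfl

lemma form_cross_four (A B C D : V) : form (cross A B C D) D = 0 := by
  rw [form_cross]
  exact Matrix.det_zero_of_row_eq (i := 4) (j := 3) (by decide) rfl

lemma contDiffOn_cross {s : Set ℝ} {A B C D : ℝ → V} (hA : ContDiffOn ℝ ∞ A s)
    (hB : ContDiffOn ℝ ∞ B s) (hC : ContDiffOn ℝ ∞ C s) (hD : ContDiffOn ℝ ∞ D s) :
    ContDiffOn ℝ ∞ (fun u => cross (A u) (B u) (C u) (D u)) s := by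
  refine contDiffOn_pi.2 fun j => ?_
  simp only [cross, Matrix.det_apply]
  refine contDiffOn_const.mul (contDiffOn_const.mul (ContDiffOn.sum fun σ _ => ?_))
  refine ContDiffOn.const_smul _ (contDiffOn_prod fun i _ => ?_)
  have hA' := contDiffOn_pi.1 hA
  have hB' := contDiffOn_pi.1 hB
  have hC' := contDiffOn_pi.1 hC
  have hD' := contDiffOn_pi.1 hD
  simp only [Matrix.submatrix_apply, id, Matrix.of_apply]
  generalize σ i = l
  fin_cases l
  exacts [hA' _, hB' _, hC' _, hD' _]

/-- Relations between the members other than `B₃` of a Möbius basis. -/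
structure IsPartialMobius (A B C D : V) : Prop where
  r00 : form A A = 0
  r01 : form A B = 0
  r02 : form A C = 0
  r04 : form A D = -1
  r11 : form B B = -1
  r12 : form B C = 0
  r14 : form B D = 0
  r22 : form C C = 1
  r24 : form C D = 0
  r44 : form D D = 0

namespace IsPartialMobius

variable {A B C D : V}

lemma ne_zero (h : IsPartialMobius A B C D) : A ≠ 0 := by
  rintro rfl
  simpa using h.r04

lemma det_sq (h : IsPartialMobius A B C D) {Z : V} (h0 : form A Z = 0) (h1 : form B Z = 0)
    (h2 : form C Z = 0) (h4 : form D Z = 0) :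
    (Matrix.of ![A, B, C, Z, D]).det ^ 2 = form Z Z := by
  rw [← det_gram]
  have : Matrix.of (fun i j => form (![A, B, C, Z, D] i) (![A, B, C, Z, D] j))
      = !![0, 0, 0, 0, -1; 0, -1, 0, 0, 0; 0, 0, 1, 0, 0; 0, 0, 0, form Z Z, 0;
          -1, 0, 0, 0, 0] := by
    ext i j
    fin_cases i <;> fin_cases j <;>
      simp [h.r00, h.r01, h.r02, h.r04, h.r11, h.r12, h.r14, h.r22, h.r24, h.r44, h0, h1, h2, h4,
        form_comm B A, form_comm C A, form_comm Z A, form_comm D A, form_comm C B, form_comm Z B,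
        form_comm D B, form_comm Z C, form_comm D C, form_comm Z D]
  rw [this]
  simp [Matrix.det_succ_row_zero, Fin.sum_univ_succ, Fin.succAbove]
  ring

lemma exists_orthogonal (h : IsPartialMobius A B C D) : ∃ Z : V, form A Z = 0 ∧ form B Z = 0 ∧
    form C Z = 0 ∧ form D Z = 0 ∧ (Matrix.of ![A, B, C, Z, D]).det ≠ 0 := by
  have hdet : (Matrix.of ![A, B, C, A, D] * Matrix.diagonal ![-1, -1, 1, 1, 1]).det = 0 := by
    rw [Matrix.det_mul, Matrix.det_zero_of_row_eq (M := Matrix.of ![A, B, C, A, D])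
      (i := 0) (j := 3) (by decide) rfl, zero_mul]
  obtain ⟨Z, hZ, hZ0⟩ := Matrix.exists_mulVec_eq_zero_iff.2 hdet
  have hform (j : Fin 5) : form (![A, B, C, A, D] j) Z = 0 := by
    have := congrFun hZ0 j
    simp only [Matrix.mulVec, dotProduct, Matrix.mul_diagonal, Fin.sum_univ_five] at this
    rw [form_apply]
    simp at this ⊢
    linarith
  have h0 : form A Z = 0 := hform 0
  have h1 : form B Z = 0 := hform 1
  have h2 : form C Z = 0 := hform 2
  have h4 : form D Z = 0 := hform 4
  refine ⟨Z, h0, h1, h2, h4, fun hd => hZ ?_⟩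
  have hZZ : form Z Z = 0 := by rw [← h.det_sq h0 h1 h2 h4, hd]; norm_num
  obtain ⟨c, rfl⟩ := eq_smul_of_form_self_eq_zero h.r00 h.r01 h0 h1 h.r11
    (sq_add_sq_pos_of_null h.r00 h.ne_zero) hZZ
  have : c = 0 := by simpa [form_comm D A, h.r04] using h4
  rw [this, zero_smul]

/-- The vector product of the four vectors is a unit vector. -/
lemma form_cross_self (h : IsPartialMobius A B C D) :
    form (cross A B C D) (cross A B C D) = 1 := by
  obtain ⟨Z, h0, h1, h2, h4, hd⟩ := h.exists_orthogonal
  have hZZ := h.det_sq h0 h1 h2 h4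
  have hc := form_cross A B C D Z
  set d := (Matrix.of ![A, B, C, Z, D]).det with hd'
  -- the orthogonal complement of the four vectors is the line through `Z`
  have hX : cross A B C D = d⁻¹ • Z := by
    refine eq_of_form_eq (B := ![A, B, C, Z, D]) hd fun j => ?_
    fin_cases j
    · simpa [h0] using (form_comm _ _).trans (form_cross_zero A B C D)
    · simpa [h1] using (form_comm _ _).trans (form_cross_one A B C D)
    · simpa [h2] using (form_comm _ _).trans (form_cross_two A B C D)
    · simp [form_comm Z, hc, ← hZZ]
      field_simp
    · simpa [h4] using (form_comm _ _).trans (form_cross_four A B C D)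
  rw [hX]
  simp [← hZZ]
  field_simp

lemma isMobiusBasis (h : IsPartialMobius A B C D) (hfut : 0 < timeArea A (B + C)) :
    IsMobiusBasis ![A, B, C, cross A B C D, D] where
  gram i j := by
    have h0 := form_cross_zero A B C D
    have h1 := form_cross_one A B C D
    have h2 := form_cross_two A B C D
    have h3 := h.form_cross_self
    have h4 := form_cross_four A B C D
    fin_cases i <;> fin_cases j <;>
      simp [mobiusGram, h.r00, h.r01, h.r02, h.r04, h.r11, h.r12, h.r14, h.r22, h.r24, h.r44,
        form_comm B A, form_comm C A, form_comm A (cross _ _ _ _), form_comm D A, form_comm C B,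
        form_comm B (cross _ _ _ _), form_comm D B, form_comm C (cross _ _ _ _), form_comm D C,
        form_comm D (cross _ _ _ _), h0, h1, h2, h3, h4]
  oriented := by rw [← form_cross, h.form_cross_self]; exact one_pos
  future := (isFutureBivector_iff _ _).2 hfut

end IsPartialMobius

/-! ### The canonical conformal frame -/

/-- The lift of `γ` to the null cone whose derivative is a unit timelike vector. -/
def conformalLift (γ : ℝ → V) (u : ℝ) : V := (speed (deriv γ u))⁻¹ • γ u

lemma contDiffOn_speed_inv {E : Type*} [NormedAddCommGroup E] [NormedSpace ℝ E] {s : Set E}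
    {w : E → V} (hw : ContDiffOn ℝ ∞ w s) (hneg : ∀ p ∈ s, form (w p) (w p) < 0) :
    ContDiffOn ℝ ∞ (fun p => (speed (w p))⁻¹) s := by
  refine ContDiffOn.inv ?_ fun p hp => (speed_pos (hneg p hp)).ne'
  exact (contDiffOn_form hw hw).neg.sqrt fun p hp => (neg_pos.2 (hneg p hp)).ne'

namespace IsTimelikeCurve

variable {γ : ℝ → V} {I : Set ℝ}

lemma contDiffOn_lift (hI : IsOpen I) (hγ : IsTimelikeCurve γ I) :
    ContDiffOn ℝ ∞ (conformalLift γ) I :=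
  (contDiffOn_speed_inv (contDiffOn_deriv hI hγ.smooth) hγ.timelike).smul hγ.smooth

lemma form_lift (hγ : IsTimelikeCurve γ I) {u : ℝ} (hu : u ∈ I) :
    form (conformalLift γ u) (conformalLift γ u) = 0 := by
  simp [conformalLift, form_self_eq_zero_of_mem (hγ.mem u hu)]

lemma form_deriv (hI : IsOpen I) (hγ : IsTimelikeCurve γ I) {u : ℝ} (hu : u ∈ I) :
    form (γ u) (deriv γ u) = 0 := by
  have hd := hasDerivAt_of_contDiffOn hI hγ.smooth hu
  have := hasDerivAt_unique_of_eqOn hI (fun v hv => form_self_eq_zero_of_mem (hγ.mem v hv)) hu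
    (hasDerivAt_form hd hd) (hasDerivAt_const u 0)
  rw [form_comm (deriv γ u)] at this
  linarith

lemma exists_deriv_lift (hI : IsOpen I) (hγ : IsTimelikeCurve γ I) {u : ℝ} (hu : u ∈ I) :
    ∃ g' : ℝ, deriv (conformalLift γ) u = g' • γ u + (speed (deriv γ u))⁻¹ • deriv γ u := by
  have h1 := hasDerivAt_of_contDiffOn hI
    (contDiffOn_speed_inv (contDiffOn_deriv hI hγ.smooth) hγ.timelike) hu
  exact ⟨_, (h1.smul (hasDerivAt_of_contDiffOn hI hγ.smooth hu)).deriv.trans (add_comm _ _)⟩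

lemma form_deriv_lift (hI : IsOpen I) (hγ : IsTimelikeCurve γ I) {u : ℝ} (hu : u ∈ I) :
    form (deriv (conformalLift γ) u) (deriv (conformalLift γ) u) = -1 := by
  obtain ⟨g', hg'⟩ := hγ.exists_deriv_lift hI hu
  rw [hg']
  exact form_deriv_normalized (form_self_eq_zero_of_mem (hγ.mem u hu)) (hγ.form_deriv hI hu)
    (hγ.timelike u hu)

lemma timeArea_lift_pos (hI : IsOpen I) (hγ : IsTimelikeCurve γ I) {u : ℝ} (hu : u ∈ I) :
    0 < timeArea (conformalLift γ u) (deriv (conformalLift γ) u) := by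
  obtain ⟨g', hg'⟩ := hγ.exists_deriv_lift hI hu
  obtain ⟨ρ, hρ, h0, h1⟩ := hγ.future u hu
  have hs := inv_pos.2 (speed_pos (hγ.timelike u hu))
  have : timeArea (conformalLift γ u) (deriv (conformalLift γ) u)
      = (speed (deriv γ u))⁻¹ ^ 2 * ρ := by
    rw [hg']
    simp only [timeArea, conformalLift, Pi.smul_apply, Pi.add_apply, smul_eq_mul, h0, h1]
    linear_combination (speed (deriv γ u))⁻¹ ^ 2 * ρ * (hγ.mem u hu).1
  rw [this]
  positivity

lemma strainDensity_eq (hI : IsOpen I) (hγ : IsTimelikeCurve γ I) {X₁ X₂ X₃ : ℝ → V}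
    (h1 : ∀ u ∈ I, HasDerivAt (conformalLift γ) (X₁ u) u) (h2 : ∀ u ∈ I, HasDerivAt X₁ (X₂ u) u)
    (h3 : ∀ u ∈ I, HasDerivAt X₂ (X₃ u) u) {u : ℝ} (hu : u ∈ I) :
    strainDensity γ u = (form (X₃ u) (X₃ u) + form (X₂ u) (X₂ u) ^ 2) ^ (1 / 4 : ℝ) := by
  refine strainDensity_eq_of_eqOn_smul hI h1 h2 h3 (fun v hv => hγ.form_lift hv)
    (fun v hv => ?_) (f := fun v => speed (deriv γ v)) ?_
    (fun v hv => speed_pos (hγ.timelike v hv)) (fun v hv => ?_) hu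
  · rw [← (h1 v hv).deriv]
    exact hγ.form_deriv_lift hI hv
  · have hd := contDiffOn_deriv hI hγ.smooth
    exact (contDiffOn_form hd hd).neg.sqrt fun p hp => (neg_pos.2 (hγ.timelike p hp)).ne'
  · rw [conformalLift, smul_inv_smul₀ (speed_pos (hγ.timelike v hv)).ne']

end IsTimelikeCurve

lemma eq_one_of_rpow_eq_one {x : ℝ} (hx : 0 ≤ x) (h : x ^ (1 / 4 : ℝ) = 1) : x = 1 := by
  have : (x ^ (1 / 4 : ℝ)) ^ (4 : ℝ) = x := by
    rw [← Real.rpow_mul hx]; norm_num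
  rw [← this, h, Real.one_rpow]

/-- The frame built from a normalised jet with unit normal component. -/
lemma IsUnitJet.isPartialMobius {X X₁ X₂ X₃ : V} (h : IsUnitJet X X₁ X₂ X₃)
    (h1 : form X₃ X₃ + form X₂ X₂ ^ 2 = 1) :
    IsPartialMobius X X₁ (-jetNormal X X₁ X₂ X₃) ((form X₂ X₂ / 2) • X - X₂) where
  r00 := h.r00
  r01 := h.r01
  r02 := by simp [h.form_normal_zero]
  r04 := by simp [h.r00, h.r02]
  r11 := h.r11
  r12 := by simp [h.form_normal_one]
  r14 := by simp [form_comm X₁ X, h.r01, h.r12]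
  r22 := by simp [h.form_normal_self, h1]
  r24 := by simp [form_comm _ X, form_comm _ X₂, h.form_normal_zero, h.form_normal_two]
  r44 := by
    simp [h.r00, h.r02, form_comm X₂ X]
    ring

/-- A Möbius frame that satisfies the equations for `M₀'`, `M₁'`, `M₄'` satisfies the other two
Frenet equations as well: the matrix of its derivative is skew for the scalar product. -/
lemma frenet_of_frame {J : Set ℝ} (hJ : IsOpen J) {M : Fin 5 → ℝ → V} {k h : ℝ → ℝ}
    (hM : ∀ u ∈ J, IsMobiusBasis fun j => M j u)
    (hs : ∀ j, ContDiffOn ℝ ∞ (M j) J)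
    (h0 : ∀ u ∈ J, deriv (M 0) u = M 1 u)
    (h1 : ∀ u ∈ J, deriv (M 1) u = (-h u) • M 0 u - M 4 u)
    (h4 : ∀ u ∈ J, deriv (M 4) u = h u • M 1 u + M 2 u)
    (hk : ∀ u ∈ J, k u = form (deriv (M 2) u) (M 3 u)) {u : ℝ} (hu : u ∈ J) :
    deriv (M 2) u = M 0 u + k u • M 3 u ∧ deriv (M 3) u = (-k u) • M 2 u := by
  have g (i j : Fin 5) : form (M i u) (M j u) = mobiusGram i j := (hM u hu).gram i j
  have hd (j : Fin 5) : HasDerivAt (M j) (deriv (M j) u) u := hasDerivAt_of_contDiffOn hJ (hs j) hu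
  have key (i j : Fin 5) : form (deriv (M i) u) (M j u) = -form (deriv (M j) u) (M i u) := by
    have := hasDerivAt_unique_of_eqOn hJ (fun v hv => (hM v hv).gram i j) hu
      (hasDerivAt_form (hd i) (hd j)) (hasDerivAt_const u _)
    rw [form_comm (M i u)] at this
    linarith
  have hdet := (hM u hu).oriented.ne'
  have k22 := key 2 2
  have k33 := key 3 3
  have k20 := key 2 0
  have k21 := key 2 1
  have k23 := key 2 3
  have k24 := key 2 4
  have k30 := key 3 0
  have k31 := key 3 1
  have k34 := key 3 4
  rw [h0 u hu, g] at k20 k30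
  rw [h1 u hu] at k21 k31
  rw [h4 u hu] at k24 k34
  rw [← hk u hu] at k23
  simp [g, mobiusGram] at k20 k21 k24 k30 k31 k34
  constructor
  · refine eq_of_form_eq hdet fun j => ?_
    rw [form_comm]
    fin_cases j
    · simp [g, mobiusGram, k20]
    · simp [g, mobiusGram, k21]
    · simp [g, mobiusGram]; linarith
    · simp [g, mobiusGram, hk u hu]
    · simp [g, mobiusGram, k24]
  · refine eq_of_form_eq hdet fun j => ?_
    rw [form_comm]
    fin_cases j
    · simp [g, mobiusGram, k30]
    · simp [g, mobiusGram, k31]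
    · simp [g, mobiusGram]; linarith
    · simp [g, mobiusGram]; linarith
    · simp [g, mobiusGram, k34]

/-- The canonical frame is built from the normalised lift `X` of `γ` and its derivatives. The
vector `M₃`, called `T` in the proof, is the only one that is not a combination of these. -/
theorem exists_conformalCurvatures {I : Set ℝ} (hI : IsOpen I) {γ : ℝ → V}
    (hγ : IsTimelikeCurve γ I) (hpar : IsConformalParametrization γ I) :
    ∃ k h : ℝ → ℝ, AreConformalCurvatures γ I k h := by
  obtain ⟨X, hX⟩ : ∃ X, X = conformalLift γ := ⟨_, rfl⟩
  obtain ⟨X₁, hX₁⟩ : ∃ X₁, X₁ = deriv X := ⟨_, rfl⟩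
  obtain ⟨X₂, hX₂⟩ : ∃ X₂, X₂ = deriv X₁ := ⟨_, rfl⟩
  obtain ⟨X₃, hX₃⟩ : ∃ X₃, X₃ = deriv X₂ := ⟨_, rfl⟩
  have s0 : ContDiffOn ℝ ∞ X I := hX ▸ hγ.contDiffOn_lift hI
  have s1 : ContDiffOn ℝ ∞ X₁ I := hX₁ ▸ contDiffOn_deriv hI s0
  have s2 : ContDiffOn ℝ ∞ X₂ I := hX₂ ▸ contDiffOn_deriv hI s1
  have s3 : ContDiffOn ℝ ∞ X₃ I := hX₃ ▸ contDiffOn_deriv hI s2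
  have d0 : ∀ u ∈ I, HasDerivAt X (X₁ u) u := fun u hu => hX₁ ▸ hasDerivAt_of_contDiffOn hI s0 hu
  have d1 : ∀ u ∈ I, HasDerivAt X₁ (X₂ u) u := fun u hu => hX₂ ▸ hasDerivAt_of_contDiffOn hI s1 hu
  have d2 : ∀ u ∈ I, HasDerivAt X₂ (X₃ u) u := fun u hu => hX₃ ▸ hasDerivAt_of_contDiffOn hI s2 hu
  have hjet : ∀ u ∈ I, IsUnitJet (X u) (X₁ u) (X₂ u) (X₃ u) := fun u hu => by
    refine isUnitJet_of_hasDerivAt hI d0 d1 d2 (fun v hv => ?_) (fun v hv => ?_) hu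
    · rw [hX]; exact hγ.form_lift hv
    · rw [hX₁, hX]; exact hγ.form_deriv_lift hI hv
  have hone : ∀ u ∈ I, form (X₃ u) (X₃ u) + form (X₂ u) (X₂ u) ^ 2 = 1 := fun u hu =>
    eq_one_of_rpow_eq_one (hjet u hu).strain_nonneg
      ((hγ.strainDensity_eq hI (hX ▸ d0) d1 d2 hu).symm.trans (hpar u hu))
  obtain ⟨N, hN⟩ : ∃ N : ℝ → V, N = fun u => -jetNormal (X u) (X₁ u) (X₂ u) (X₃ u) := ⟨_, rfl⟩
  obtain ⟨h, hh⟩ : ∃ h : ℝ → ℝ, h = fun u => -(form (X₂ u) (X₂ u) / 2) := ⟨_, rfl⟩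
  obtain ⟨B, hB⟩ : ∃ B : ℝ → V, B = fun u => (-h u) • X u - X₂ u := ⟨_, rfl⟩
  obtain ⟨T, hT⟩ : ∃ T : ℝ → V, T = fun u => cross (X u) (X₁ u) (N u) (B u) := ⟨_, rfl⟩
  have sh : ContDiffOn ℝ ∞ h I := by
    rw [hh]; exact ((contDiffOn_form s2 s2).div_const 2).neg
  have sN : ContDiffOn ℝ ∞ N I := by
    rw [hN]
    exact ((s3.sub ((contDiffOn_form s2 s2).smul s1)).sub ((contDiffOn_form s3 s2).smul s0)).neg
  have sB : ContDiffOn ℝ ∞ B I := by rw [hB]; exact (sh.neg.smul s0).sub s2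
  have sT : ContDiffOn ℝ ∞ T I := by rw [hT]; exact contDiffOn_cross s0 s1 sN sB
  have hpm : ∀ u ∈ I, IsPartialMobius (X u) (X₁ u) (N u) (B u) := fun u hu => by
    have := (hjet u hu).isPartialMobius (hone u hu)
    rw [hB, hN, hh]
    simpa using this
  obtain ⟨M, hM⟩ : ∃ M : Fin 5 → ℝ → V, M = ![X, X₁, N, T, B] := ⟨_, rfl⟩
  have hM0 : M 0 = X := by rw [hM]; rfl
  have hM1 : M 1 = X₁ := by rw [hM]; rfl
  have hM2 : M 2 = N := by rw [hM]; rfl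
  have hM3 : M 3 = T := by rw [hM]; rfl
  have hM4 : M 4 = B := by rw [hM]; rfl
  have hmob : ∀ u ∈ I, IsMobiusBasis fun j => M j u := fun u hu => by
    have hp := hpm u hu
    have := hp.isMobiusBasis (timeArea_add_pos hp.r00 hp.r01 hp.r02 hp.r12 hp.r11
      (sq_add_sq_pos_of_null hp.r00 hp.ne_zero) hp.r22
      (by rw [hX₁, hX]; exact hγ.timeArea_lift_pos hI hu))
    convert this using 1
    funext j
    fin_cases j <;> simp [hM, hT]
  have hsM : ∀ j, ContDiffOn ℝ ∞ (M j) I := fun j => by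
    rw [hM]
    fin_cases j
    exacts [s0, s1, sN, sT, sB]
  have e0 : ∀ u ∈ I, deriv (M 0) u = M 1 u := fun u hu => by
    rw [hM0, hM1, hX₁]
  have e1 : ∀ u ∈ I, deriv (M 1) u = (-h u) • M 0 u - M 4 u := fun u hu => by
    rw [hM0, hM1, hM4, hB, ← hX₂]; simp
  have e4 : ∀ u ∈ I, deriv (M 4) u = h u • M 1 u + M 2 u := fun u hu => by
    have hh' : HasDerivAt h (-form (X₃ u) (X₂ u)) u := by
      rw [hh]
      refine ((hasDerivAt_form (d2 u hu) (d2 u hu)).div_const 2).neg.congr_deriv ?_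
      rw [form_comm (X₂ u)]; ring
    rw [hM4, hM1, hM2, hB]
    refine ((hh'.neg.smul (d0 u hu)).sub (d2 u hu)).deriv.trans ?_
    have hx : form (X₂ u) (X₂ u) = -2 * h u := by rw [hh]; ring
    simp only [hN, jetNormal, hx, Pi.neg_apply]
    module
  obtain ⟨k, hk⟩ : ∃ k : ℝ → ℝ, k = fun u => form (deriv (M 2) u) (M 3 u) := ⟨_, rfl⟩
  have sk : ContDiffOn ℝ ∞ k I := by
    rw [hk]; exact contDiffOn_form (contDiffOn_deriv hI (hsM 2)) (hsM 3)
  have e23 := fun u hu => frenet_of_frame hI hmob hsM e0 e1 e4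
    (fun u _ => congrFun hk u) (u := u) hu
  refine ⟨k, h, M, hsM, sk, sh, hmob, fun u hu => ?_, fun u hu j => ?_⟩
  · exact ⟨_, inv_pos.2 (speed_pos (hγ.timelike u hu)), by rw [hM0, hX]; rfl⟩
  · refine (hasDerivAt_of_contDiffOn hI (hsM j) hu).congr_deriv ?_
    rw [hpar u hu, one_smul, Fin.sum_univ_five]
    fin_cases j
    · simpa [frenetMatrix] using e0 u hu
    · simpa [frenetMatrix, sub_eq_add_neg] using e1 u hu
    · simpa [frenetMatrix] using (e23 u hu).1
    · simpa [frenetMatrix] using (e23 u hu).2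
    · simpa [frenetMatrix] using e4 u hu

/-! ### The first variation of the total strain -/

namespace IsCanonicalFrame

variable {γ : ℝ → V} {I : Set ℝ} {M : Fin 5 → ℝ → V} {k h : ℝ → ℝ}

/-- The conformal Frenet equations for the conformal parameter. -/
lemma hasDerivAt (hM : IsCanonicalFrame γ I M k h) (hpar : IsConformalParametrization γ I)
    {u : ℝ} (hu : u ∈ I) :
    HasDerivAt (M 0) (M 1 u) u ∧ HasDerivAt (M 1) (-h u • M 0 u - M 4 u) u ∧
    HasDerivAt (M 2) (M 0 u + k u • M 3 u) u ∧ HasDerivAt (M 3) (-k u • M 2 u) u ∧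
    HasDerivAt (M 4) (h u • M 1 u + M 2 u) u := by
  have key := hM.frenet u hu
  refine ⟨(key 0).congr_deriv ?_, (key 1).congr_deriv ?_, (key 2).congr_deriv ?_,
    (key 3).congr_deriv ?_, (key 4).congr_deriv ?_⟩ <;>
  simp [hpar u hu, Fin.sum_univ_five, frenetMatrix, sub_eq_add_neg]

lemma form_eq (hM : IsCanonicalFrame γ I M k h) {u : ℝ} (hu : u ∈ I) (i j : Fin 5) :
    form (M i u) (M j u) = mobiusGram i j := (hM.mobius u hu).gram i j

/-- For the conformal parameter, the first vector of the canonical frame is the normalised lift. -/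
lemma zero_eq_lift (hM : IsCanonicalFrame γ I M k h) (hpar : IsConformalParametrization γ I)
    (hI : IsOpen I) (hγ : IsTimelikeCurve γ I) {u : ℝ} (hu : u ∈ I) :
    M 0 u = conformalLift γ u := by
  -- the factor `r` is a smooth function, since the time component of `γ` is a unit vector
  obtain ⟨r, hr⟩ : ∃ r : ℝ → ℝ, r = fun v => M 0 v 0 * γ v 0 + M 0 v 1 * γ v 1 := ⟨_, rfl⟩
  have hr0 : ∀ v ∈ I, 0 < r v ∧ M 0 v = r v • γ v := fun v hv => by
    obtain ⟨c, hc, hc'⟩ := hM.lift v hv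
    have : r v = c := by
      simp only [hr, hc', Pi.smul_apply, smul_eq_mul]
      linear_combination c * (hγ.mem v hv).1
    rw [this]; exact ⟨hc, hc'⟩
  have hsr : ContDiffOn ℝ ∞ r I := by
    have h0 := contDiffOn_pi.1 (hM.smooth 0)
    have h1 := contDiffOn_pi.1 hγ.smooth
    rw [hr]
    exact ((h0 0).mul (h1 0)).add ((h0 1).mul (h1 1))
  have hdγ := hasDerivAt_of_contDiffOn hI hγ.smooth hu
  have h1 := hasDerivAt_unique_of_eqOn hI (fun v hv => (hr0 v hv).2) hu
    (hM.hasDerivAt hpar hu).1 ((hasDerivAt_of_contDiffOn hI hsr hu).smul hdγ)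
  have h11 : form (M 1 u) (M 1 u) = -1 := hM.form_eq hu 1 1
  have hneg := hγ.timelike u hu
  have hsq : (r u * speed (deriv γ u)) ^ 2 = 1 := by
    rw [mul_pow, speed_sq hneg]
    rw [h1] at h11
    simp [form_self_eq_zero_of_mem (hγ.mem u hu), hγ.form_deriv hI hu,
      form_comm (deriv γ u) (γ u)] at h11
    linear_combination -h11
  have hpos := mul_pos (hr0 u hu).1 (speed_pos hneg)
  have hone : r u * speed (deriv γ u) = 1 := by nlinarith
  rw [(hr0 u hu).2, conformalLift, eq_inv_of_mul_eq_one_left hone]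

/-- Integration by parts in the first variation of the total strain. Along the canonical frame
let `Y` be an infinitesimal variation of the normalised lift `M₀`, so that `⟨M₀, Y⟩ = 0` and
`⟨M₀', Y'⟩ = 0`. The integrand `2⟨M₀''', Y'''⟩ + 4⟨M₀'', M₀''⟩⟨M₀'', Y''⟩` is the sum of an
exact derivative and of a term that contains only the components of `Y` along `M₂`, `M₃`. -/
lemma hasDerivAt_boundary (hM : IsCanonicalFrame γ I M k h)
    (hpar : IsConformalParametrization γ I) (hI : IsOpen I) {k₁ k₂ h₁ : ℝ → ℝ}
    (hk : ∀ u ∈ I, HasDerivAt k (k₁ u) u) (hk₁ : ∀ u ∈ I, HasDerivAt k₁ (k₂ u) u)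
    (hh : ∀ u ∈ I, HasDerivAt h (h₁ u) u) {Y Y₁ Y₂ Y₃ : ℝ → V}
    (hY : ∀ u ∈ I, HasDerivAt Y (Y₁ u) u) (hY₁ : ∀ u ∈ I, HasDerivAt Y₁ (Y₂ u) u)
    (hY₂ : ∀ u ∈ I, HasDerivAt Y₂ (Y₃ u) u) (hc0 : ∀ u ∈ I, form (M 0 u) (Y u) = 0)
    (hc1 : ∀ u ∈ I, form (M 1 u) (Y₁ u) = 0) {u : ℝ} (hu : u ∈ I) :
    HasDerivAt (fun u => -2 * form (M 2 u) (Y₂ u) + 2 * form (M 0 u) (Y₁ u)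
        + 2 * (k u * form (M 3 u) (Y₁ u)) - 2 * (k₁ u * form (M 3 u) (Y u))
        + (2 * k u ^ 2 - 4 * h u) * form (M 2 u) (Y u))
      (2 * form (-h₁ u • M 0 u - (2 * h u) • M 1 u - M 2 u) (Y₃ u)
        + 4 * (-2 * h u) * form (-h u • M 0 u - M 4 u) (Y₂ u)
        - 2 * ((h₁ u - 3 * k u * k₁ u) * form (M 2 u) (Y u)
          + (k₂ u - k u ^ 3 + 2 * k u * h u) * form (M 3 u) (Y u))) u := by
  have d0 := fun v hv => (hM.hasDerivAt hpar (u := v) hv).1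
  have d1 := fun v hv => (hM.hasDerivAt hpar (u := v) hv).2.1
  have d2 := fun v hv => (hM.hasDerivAt hpar (u := v) hv).2.2.1
  have d3 := fun v hv => (hM.hasDerivAt hpar (u := v) hv).2.2.2.1
  have d4 := fun v hv => (hM.hasDerivAt hpar (u := v) hv).2.2.2.2
  -- the differential consequences of the two constraints
  have c01 : ∀ v ∈ I, form (M 1 v) (Y v) + form (M 0 v) (Y₁ v) = 0 := fun v hv =>
    hasDerivAt_unique_of_eqOn hI hc0 hv (hasDerivAt_form (d0 v hv) (hY v hv))
      (hasDerivAt_const v 0)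
  have c02 : ∀ v ∈ I, form (M 0 v) (Y₂ v) = form (M 4 v) (Y v) := fun v hv => by
    have := hasDerivAt_unique_of_eqOn hI c01 hv ((hasDerivAt_form (d1 v hv) (hY v hv)).add
      (hasDerivAt_form (d0 v hv) (hY₁ v hv))) (hasDerivAt_const v 0)
    simp [hc0 v hv, hc1 v hv] at this
    linarith
  have c03 : ∀ v ∈ I, form (M 1 v) (Y₂ v) + form (M 0 v) (Y₃ v)
      = h v * form (M 1 v) (Y v) + form (M 2 v) (Y v) + form (M 4 v) (Y₁ v) := fun v hv => by
    have := hasDerivAt_unique_of_eqOn hI c02 hv (hasDerivAt_form (d0 v hv) (hY₂ v hv))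
      (hasDerivAt_form (d4 v hv) (hY v hv))
    simpa using this
  have c12 : ∀ v ∈ I, -(h v * form (M 0 v) (Y₁ v)) - form (M 4 v) (Y₁ v) + form (M 1 v) (Y₂ v)
      = 0 := fun v hv => by
    have := hasDerivAt_unique_of_eqOn hI hc1 hv (hasDerivAt_form (d1 v hv) (hY₁ v hv))
      (hasDerivAt_const v 0)
    simpa using this
  have c13 : form (M 1 u) (Y₃ u) = h₁ u * form (M 0 u) (Y₁ u) + 2 * h u * form (M 0 u) (Y₂ u)
      + form (M 2 u) (Y₁ u) + 2 * form (M 4 u) (Y₂ u) := by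
    have := hasDerivAt_unique_of_eqOn hI c12 hu
      ((((hh u hu).mul (hasDerivAt_form (d0 u hu) (hY₁ u hu))).neg.sub
        (hasDerivAt_form (d4 u hu) (hY₁ u hu))).add (hasDerivAt_form (d1 u hu) (hY₂ u hu)))
      (hasDerivAt_const u 0)
    simp [hc1 u hu] at this
    linarith
  have e01 := c01 u hu
  have e02 := c02 u hu
  have e03 := c03 u hu
  have e12 := c12 u hu
  have a00 := hc0 u hu
  have a11 := hc1 u hu
  refine ((((((hasDerivAt_form (d2 u hu) (hY₂ u hu)).const_mul (-2)).add
    ((hasDerivAt_form (d0 u hu) (hY₁ u hu)).const_mul 2)).add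
    (((hk u hu).mul (hasDerivAt_form (d3 u hu) (hY₁ u hu))).const_mul 2)).sub
    (((hk₁ u hu).mul (hasDerivAt_form (d3 u hu) (hY u hu))).const_mul 2)).add
    (((((hk u hu).pow 2).const_mul 2).sub ((hh u hu).const_mul 4)).mul
      (hasDerivAt_form (d2 u hu) (hY u hu)))).congr_deriv ?_
  simp only [map_add, map_sub, map_neg, map_smul, LinearMap.add_apply, LinearMap.sub_apply,
    LinearMap.smul_apply, LinearMap.neg_apply, smul_eq_mul, neg_smul, Nat.cast_ofNat,
    Nat.add_one_sub_one, pow_one, Pi.sub_apply, Pi.pow_apply]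
  have f03 : form (M 0 u) (Y₃ u) = 2 * h u * form (M 1 u) (Y u) + form (M 2 u) (Y u) := by
    linear_combination e03 - e12 - h u * e01
  rw [c13, f03, a00, a11]
  have f01 : form (M 0 u) (Y₁ u) = -form (M 1 u) (Y u) := by linarith
  rw [f01]
  ring

end IsCanonicalFrame

lemma eventually_forall_mem_of_Icc_prod_subset {U : Set (ℝ × ℝ)} (hU : IsOpen U) {a b : ℝ}
    (hK : Set.Icc a b ×ˢ {(0 : ℝ)} ⊆ U) :
    ∀ᶠ t in nhds (0 : ℝ), ∀ u ∈ Set.Icc a b, (u, t) ∈ U := by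
  obtain ⟨v, w, -, hw, hav, h0w, hvw⟩ :=
    generalized_tube_lemma isCompact_Icc isCompact_singleton hU hK
  filter_upwards [hw.mem_nhds (h0w rfl)] with t ht u hu
  exact hvw ⟨hav hu, ht⟩

/-- The derivative of the total strain along a family of curves whose normalised lift `X` is
smooth. Since the strain density `(⟨X''', X'''⟩ + ⟨X'', X''⟩²)^(1/4)` is `1` at `t = 0`, its
derivative there is a quarter of the derivative of its fourth power. -/
lemma hasDerivAt_integral_rpow {U : Set (ℝ × ℝ)} (hU : IsOpen U) {X₂ X₃ : ℝ × ℝ → V}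
    (h2 : ContDiffOn ℝ ∞ X₂ U) (h3 : ContDiffOn ℝ ∞ X₃ U) {a b : ℝ} (hab : a ≤ b)
    (hK : Set.Icc a b ×ˢ {(0 : ℝ)} ⊆ U)
    (h1 : ∀ u ∈ Set.Icc a b, form (X₃ (u, 0)) (X₃ (u, 0)) + form (X₂ (u, 0)) (X₂ (u, 0)) ^ 2 = 1) :
    HasDerivAt (fun t => ∫ u in a..b,
        (form (X₃ (u, t)) (X₃ (u, t)) + form (X₂ (u, t)) (X₂ (u, t)) ^ 2) ^ (1 / 4 : ℝ))
      (∫ u in a..b, 1 / 4 * (2 * form (X₃ (u, 0)) (partialT X₃ (u, 0))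
        + 4 * form (X₂ (u, 0)) (X₂ (u, 0)) * form (X₂ (u, 0)) (partialT X₂ (u, 0)))) 0 := by
  obtain ⟨G, hG⟩ : ∃ G : ℝ × ℝ → ℝ, G = fun p => form (X₃ p) (X₃ p) + form (X₂ p) (X₂ p) ^ 2 :=
    ⟨_, rfl⟩
  have sG : ContDiffOn ℝ ∞ G U := by
    rw [hG]; exact (contDiffOn_form h3 h3).add ((contDiffOn_form h2 h2).pow 2)
  have hO : IsOpen (U ∩ G ⁻¹' Set.Ioi 0) := sG.continuousOn.isOpen_inter_preimage hU isOpen_Ioi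
  have hG1 : ∀ u ∈ Set.Icc a b, G (u, 0) = 1 := fun u hu => by rw [hG]; exact h1 u hu
  have hK' : Set.Icc a b ×ˢ {(0 : ℝ)} ⊆ U ∩ G ⁻¹' Set.Ioi 0 := by
    rintro ⟨u, t⟩ ⟨hu, rfl : t = 0⟩
    refine ⟨hK ⟨hu, rfl⟩, ?_⟩
    rw [Set.mem_preimage, hG1 u hu]
    exact (one_pos : (0 : ℝ) < 1)
  have sf : ContDiffOn ℝ ∞ (fun p => G p ^ (1 / 4 : ℝ)) (U ∩ G ⁻¹' Set.Ioi 0) :=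
    (sG.mono Set.inter_subset_left).rpow_const_of_ne fun p hp => (Set.mem_Ioi.1 hp.2).ne'
  have hmain := hasDerivAt_intervalIntegral_of_contDiffOn hO sf hab hK'
  simp only [hG] at hmain
  refine hmain.congr_deriv (intervalIntegral.integral_congr fun u hu => ?_)
  rw [Set.uIcc_of_le hab] at hu
  have hp : (u, (0 : ℝ)) ∈ U := hK ⟨hu, rfl⟩
  have e2 := hasDerivAt_partialT hU h2 hp
  have e3 := hasDerivAt_partialT hU h3 hp
  have eG := (hasDerivAt_form e3 e3).add ((hasDerivAt_form e2 e2).pow 2)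
  have ef := eG.rpow_const (p := (1 / 4 : ℝ)) (Or.inl (by
    have := h1 u hu
    simp only [Pi.add_apply, Pi.pow_apply]
    rw [this]; exact one_ne_zero))
  have := (hasDerivAt_partialT hO sf (hK' ⟨hu, rfl⟩)).unique
    (by simpa only [hG, Pi.add_apply, Pi.pow_apply] using ef)
  simp only [hG] at this
  refine this.trans ?_
  rw [h1 u hu, Real.one_rpow, form_comm (partialT X₃ (u, 0)), form_comm (partialT X₂ (u, 0))]
  norm_num
  ring

namespace IsCanonicalFrame

variable {γ : ℝ → V} {I : Set ℝ} {M : Fin 5 → ℝ → V} {k h : ℝ → ℝ}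

/-- The first variation of the total strain. The factor `(speed γ')⁻¹` turns the derivative of the
varied curves into that of their normalised lifts, up to a multiple of `M₀`, and `M₀` is orthogonal
to `M₂` and `M₃`. -/
theorem hasDerivAt_totalStrain (hM : IsCanonicalFrame γ I M k h)
    (hpar : IsConformalParametrization γ I) (hI : IsOpen I) (hγ : IsTimelikeCurve γ I)
    {a b ε : ℝ} (hab : a ≤ b) (hs : Set.Icc a b ⊆ I) (hε : 0 < ε) {Γ : ℝ → ℝ → V}
    (hΓ : IsVariation γ I a b ε Γ) :
    HasDerivAt (fun t => totalStrain (fun u => Γ u t) a b)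
      (1 / 2 * ∫ u in a..b, (speed (deriv γ u))⁻¹ *
        ((deriv h u - 3 * k u * deriv k u) * form (M 2 u) (deriv (Γ u) 0)
        + (deriv (deriv k) u - k u ^ 3 + 2 * k u * h u) * form (M 3 u) (deriv (Γ u) 0))) 0 := by
  obtain ⟨F, hF⟩ : ∃ F : ℝ × ℝ → V, F = fun p => Γ p.1 p.2 := ⟨_, rfl⟩
  have hW : IsOpen (I ×ˢ Set.Ioo (-ε) ε) := hI.prod isOpen_Ioo
  have sF' : ContDiffOn ℝ ∞ F (I ×ˢ Set.Ioo (-ε) ε) := hF ▸ hΓ.smooth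
  have sF1' := contDiffOn_partialU hW sF'
  -- the open set on which the varied curves are timelike
  obtain ⟨U, hUdef⟩ : ∃ U : Set (ℝ × ℝ), U = I ×ˢ Set.Ioo (-ε) ε ∩
    (fun p => form (partialU F p) (partialU F p)) ⁻¹' Set.Iio 0 := ⟨_, rfl⟩
  have hU : IsOpen U := by
    rw [hUdef]
    exact (contDiffOn_form sF1' sF1').continuousOn.isOpen_inter_preimage hW isOpen_Iio
  have hUW : U ⊆ I ×ˢ Set.Ioo (-ε) ε := hUdef ▸ Set.inter_subset_left
  have hneg : ∀ p ∈ U, form (partialU F p) (partialU F p) < 0 := fun p hp => by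
    rw [hUdef] at hp; exact hp.2
  have sF := sF'.mono hUW
  have sF1 := contDiffOn_partialU hU sF
  have hFnull : ∀ p ∈ U, form (F p) (F p) = 0 := fun p hp => by
    rw [hF]
    exact form_self_eq_zero_of_mem (hΓ.mem _ (hUW hp).1 _ (hUW hp).2)
  have hslice (t : ℝ) : IsOpen {u | (u, t) ∈ U} := hU.preimage (by fun_prop)
  have hsliceT (u : ℝ) : IsOpen {t | (u, t) ∈ U} := hU.preimage (by fun_prop)
  have hFd : ∀ u t, (u, t) ∈ U → form (F (u, t)) (partialU F (u, t)) = 0 := fun u t hp => by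
    have hd := hasDerivAt_partialU hU sF hp
    have := hasDerivAt_unique_of_eqOn (hslice t) (fun v hv => hFnull (v, t) hv) hp
      (hasDerivAt_form hd hd) (hasDerivAt_const u 0)
    rw [form_comm (partialU F (u, t))] at this
    linarith
  -- the normalised lifts of the varied curves
  obtain ⟨g, hg⟩ : ∃ g : ℝ × ℝ → ℝ, g = fun p => (speed (partialU F p))⁻¹ := ⟨_, rfl⟩
  obtain ⟨X, hX⟩ : ∃ X : ℝ × ℝ → V, X = fun p => g p • F p := ⟨_, rfl⟩
  have sg : ContDiffOn ℝ ∞ g U := hg ▸ contDiffOn_speed_inv sF1 hneg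
  have sX : ContDiffOn ℝ ∞ X U := hX ▸ sg.smul sF
  have sX1 := contDiffOn_partialU hU sX
  have sX2 := contDiffOn_partialU hU sX1
  have sX3 := contDiffOn_partialU hU sX2
  have hXnull : ∀ p ∈ U, form (X p) (X p) = 0 := fun p hp => by
    simp [hX, hFnull p hp]
  have hXunit : ∀ u t, (u, t) ∈ U → form (partialU X (u, t)) (partialU X (u, t)) = -1 :=
    fun u t hp => by
      have hd : HasDerivAt (fun u => X (u, t))
          (g (u, t) • partialU F (u, t) + partialU g (u, t) • F (u, t)) u := by
        rw [hX]
        exact (hasDerivAt_partialU hU sg hp).smul (hasDerivAt_partialU hU sF hp)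
      rw [(hasDerivAt_partialU hU sX hp).unique hd, add_comm, hg]
      exact form_deriv_normalized (hFnull _ hp) (hFd u t hp) (hneg _ hp)
  have hstrain : ∀ u t, (u, t) ∈ U → strainDensity (fun u => Γ u t) u
      = (form (partialU (partialU (partialU X)) (u, t)) (partialU (partialU (partialU X)) (u, t))
        + form (partialU (partialU X) (u, t)) (partialU (partialU X) (u, t)) ^ 2) ^ (1 / 4 : ℝ) :=
    fun u t hp => by
      refine strainDensity_eq_of_eqOn_smul (hslice t) (X := fun u => X (u, t))
        (X₁ := fun u => partialU X (u, t)) (X₂ := fun u => partialU (partialU X) (u, t))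
        (X₃ := fun u => partialU (partialU (partialU X)) (u, t))
        (fun v hv => hasDerivAt_partialU hU sX hv) (fun v hv => hasDerivAt_partialU hU sX1 hv)
        (fun v hv => hasDerivAt_partialU hU sX2 hv) (fun v hv => hXnull _ hv)
        (fun v hv => hXunit v t hv) (f := fun v => speed (partialU F (v, t))) ?_
        (fun v hv => speed_pos (hneg _ hv)) (fun v hv => ?_) hp
      · have hc : ContDiffOn ℝ ∞ (fun v => partialU F (v, t)) {u | (u, t) ∈ U} :=
          sF1.comp (by fun_prop) fun v hv => hv
        exact (contDiffOn_form hc hc).neg.sqrt fun v hv => (neg_pos.2 (hneg _ hv)).ne'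
      · simp only [hX, hg]
        rw [smul_inv_smul₀ (speed_pos (hneg _ hv)).ne', hF]
  -- the values at `t = 0`
  have h0ε : (0 : ℝ) ∈ Set.Ioo (-ε) ε := ⟨by linarith, hε⟩
  have hF0 : ∀ u ∈ I, F (u, 0) = γ u := fun u hu => by rw [hF]; exact hΓ.zero u hu
  have hF10 : ∀ u ∈ I, partialU F (u, 0) = deriv γ u := fun u hu =>
    hasDerivAt_unique_of_eqOn hI hF0 hu (hasDerivAt_partialU hW sF' ⟨hu, h0ε⟩)
      (hasDerivAt_of_contDiffOn hI hγ.smooth hu)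
  have hU0 : ∀ u ∈ I, (u, (0 : ℝ)) ∈ U := fun u hu => by
    rw [hUdef]
    refine ⟨⟨hu, h0ε⟩, ?_⟩
    rw [Set.mem_preimage, hF10 u hu]
    exact hγ.timelike u hu
  have hX0 : ∀ u ∈ I, X (u, 0) = M 0 u := fun u hu => by
    rw [hM.zero_eq_lift hpar hI hγ hu]
    simp only [hX, hg, hF10 u hu, hF0 u hu]
    rfl
  have dh := fun u hu => hasDerivAt_of_contDiffOn hI hM.smooth_h (u := u) hu
  have dk := fun u hu => hasDerivAt_of_contDiffOn hI hM.smooth_k (u := u) hu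
  have dk1 := fun u hu => hasDerivAt_of_contDiffOn hI (contDiffOn_deriv hI hM.smooth_k) (u := u) hu
  have hX1 : ∀ u ∈ I, partialU X (u, 0) = M 1 u := fun u hu =>
    hasDerivAt_unique_of_eqOn hI hX0 hu (hasDerivAt_partialU hU sX (hU0 u hu))
      (hM.hasDerivAt hpar hu).1
  have hX2 : ∀ u ∈ I, partialU (partialU X) (u, 0) = -h u • M 0 u - M 4 u := fun u hu =>
    hasDerivAt_unique_of_eqOn hI hX1 hu (hasDerivAt_partialU hU sX1 (hU0 u hu))
      (hM.hasDerivAt hpar hu).2.1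
  have hX3 : ∀ u ∈ I, partialU (partialU (partialU X)) (u, 0)
      = -deriv h u • M 0 u - (2 * h u) • M 1 u - M 2 u := fun u hu => by
    obtain ⟨m0, -, -, -, m4⟩ := hM.hasDerivAt hpar hu
    refine (hasDerivAt_unique_of_eqOn hI hX2 hu (hasDerivAt_partialU hU sX2 (hU0 u hu))
      (((dh u hu).neg.smul m0).sub m4)).trans ?_
    simp only [Pi.neg_apply]
    module
  have hX22 : ∀ u ∈ I, form (partialU (partialU X) (u, 0)) (partialU (partialU X) (u, 0))
      = -2 * h u := fun u hu => by
    rw [hX2 u hu]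
    simp [hM.form_eq hu, mobiusGram]
    ring
  have hX33 : ∀ u ∈ I, form (partialU (partialU (partialU X)) (u, 0))
      (partialU (partialU (partialU X)) (u, 0)) = 1 - 4 * h u ^ 2 := fun u hu => by
    rw [hX3 u hu]
    simp [hM.form_eq hu, mobiusGram]
    ring
  -- the infinitesimal variation of the normalised lift and its derivatives
  obtain ⟨Y, hY⟩ : ∃ Y, Y = partialT X := ⟨_, rfl⟩
  have sY : ContDiffOn ℝ ∞ Y U := hY ▸ contDiffOn_partialT hU sX
  have sY1 := contDiffOn_partialU hU sY
  have sY2 := contDiffOn_partialU hU sY1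
  have sY3 := contDiffOn_partialU hU sY2
  have hT1 : Set.EqOn (partialT (partialU X)) (partialU Y) U := hY ▸ partialT_partialU hU sX
  have hT2 : Set.EqOn (partialT (partialU (partialU X))) (partialU (partialU Y)) U :=
    (partialT_partialU hU sX1).trans (partialU_congr hU hT1)
  have hT3 : Set.EqOn (partialT (partialU (partialU (partialU X))))
      (partialU (partialU (partialU Y))) U :=
    (partialT_partialU hU sX2).trans (partialU_congr hU hT2)
  have hc0 : ∀ u ∈ I, form (M 0 u) (Y (u, 0)) = 0 := fun u hu => by
    have hd := hasDerivAt_partialT hU sX (hU0 u hu)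
    have := hasDerivAt_unique_of_eqOn (hsliceT u) (fun t ht => hXnull (u, t) ht) (hU0 u hu)
      (hasDerivAt_form hd hd) (hasDerivAt_const 0 0)
    rw [← hX0 u hu, hY]
    rw [form_comm (partialT X (u, 0))] at this
    linarith
  have hc1 : ∀ u ∈ I, form (M 1 u) (partialU Y (u, 0)) = 0 := fun u hu => by
    have hd := hasDerivAt_partialT hU sX1 (hU0 u hu)
    have := hasDerivAt_unique_of_eqOn (hsliceT u) (fun t ht => hXunit u t ht) (hU0 u hu)
      (hasDerivAt_form hd hd) (hasDerivAt_const 0 (-1))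
    rw [hT1 (hU0 u hu), form_comm (partialU Y (u, 0)), hX1 u hu] at this
    linarith
  have hYW : ∀ u ∈ I, ∀ i : Fin 5, mobiusGram i 0 = 0 →
      form (M i u) (Y (u, 0)) = (speed (deriv γ u))⁻¹ * form (M i u) (deriv (Γ u) 0) :=
    fun u hu i hi => by
      have hd : HasDerivAt (fun t => X (u, t))
          (g (u, 0) • partialT F (u, 0) + partialT g (u, 0) • F (u, 0)) 0 := by
        rw [hX]
        exact (hasDerivAt_partialT hU sg (hU0 u hu)).smul (hasDerivAt_partialT hU sF (hU0 u hu))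
      have hYe := (hasDerivAt_partialT hU sX (hU0 u hu)).unique hd
      have hFt := (hasDerivAt_partialT hU sF (hU0 u hu)).deriv
      simp only [hF] at hFt
      change deriv (Γ u) 0 = _ at hFt
      have hMγ : form (M i u) (γ u) = 0 := by
        obtain ⟨r, hr, hr'⟩ := hM.lift u hu
        have := hM.form_eq hu i 0
        rw [hr', hi] at this
        simpa [hr.ne'] using this
      rw [hFt, ← hF, hY, hYe]
      simp [hF0 u hu, hMγ, hg, hF10 u hu]
  -- the support condition
  have hY0 : ∀ u ∈ I, u ∉ Set.Icc a b → Y (u, 0) = 0 := fun u hu hn => by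
    have hO : IsOpen (I \ Set.Icc a b) := hI.sdiff isClosed_Icc
    have hXc : ∀ t ∈ {t | (u, t) ∈ U}, X (u, t) = X (u, 0) := fun t ht => by
      have htε := (hUW ht).2
      have hFt : ∀ v ∈ I \ Set.Icc a b, F (v, t) = γ v := fun v hv => by
        rw [hF]; exact hΓ.support v hv.1 hv.2 t htε
      have hF1 : partialU F (u, t) = deriv γ u :=
        hasDerivAt_unique_of_eqOn hO hFt ⟨hu, hn⟩ (hasDerivAt_partialU hU sF ht)
          (hasDerivAt_of_contDiffOn hI hγ.smooth hu)
      simp only [hX, hg]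
      rw [hF1, hFt u ⟨hu, hn⟩, hF10 u hu, hF0 u hu]
    rw [hY]
    exact hasDerivAt_unique_of_eqOn (hsliceT u) hXc (hU0 u hu)
      (hasDerivAt_partialT hU sX (hU0 u hu)) (hasDerivAt_const 0 _)
  have hO : IsOpen (I \ Set.Icc a b) := hI.sdiff isClosed_Icc
  have hY10 : ∀ u ∈ I, u ∉ Set.Icc a b → partialU Y (u, 0) = 0 := fun u hu hn =>
    hasDerivAt_unique_of_eqOn hO (fun v hv => hY0 v hv.1 hv.2) ⟨hu, hn⟩
      (hasDerivAt_partialU hU sY (hU0 u hu)) (hasDerivAt_const u 0)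
  have hY20 : ∀ u ∈ I, u ∉ Set.Icc a b → partialU (partialU Y) (u, 0) = 0 := fun u hu hn =>
    hasDerivAt_unique_of_eqOn hO (fun v hv => hY10 v hv.1 hv.2) ⟨hu, hn⟩
      (hasDerivAt_partialU hU sY1 (hU0 u hu)) (hasDerivAt_const u 0)
  have hcont {f : ℝ × ℝ → V} (hf : ContDiffOn ℝ ∞ f U) : ContDiffOn ℝ ∞ (fun u => f (u, 0)) I :=
    hf.comp (by fun_prop) hU0
  have z0 := eq_zero_of_eqOn_compl_Icc hI hab hs (hcont sY).continuousOn hY0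
  have z1 := eq_zero_of_eqOn_compl_Icc hI hab hs (hcont sY1).continuousOn hY10
  have z2 := eq_zero_of_eqOn_compl_Icc hI hab hs (hcont sY2).continuousOn hY20
  -- differentiation under the integral sign, and integration by parts
  have hK : Set.Icc a b ×ˢ {(0 : ℝ)} ⊆ U := by
    rintro ⟨u, t⟩ ⟨hu, rfl : t = 0⟩
    exact hU0 u (hs hu)
  have hmain := hasDerivAt_integral_rpow hU sX2 sX3 hab hK fun u hu => by
    rw [hX22 u (hs hu), hX33 u (hs hu)]; ring
  have hcongr : (fun t => totalStrain (fun u => Γ u t) a b) =ᶠ[nhds 0] fun t => ∫ u in a..b,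
      (form (partialU (partialU (partialU X)) (u, t)) (partialU (partialU (partialU X)) (u, t))
        + form (partialU (partialU X) (u, t)) (partialU (partialU X) (u, t)) ^ 2)
          ^ (1 / 4 : ℝ) := by
    filter_upwards [eventually_forall_mem_of_Icc_prod_subset hU hK] with t ht
    refine intervalIntegral.integral_congr fun u hu => ?_
    rw [Set.uIcc_of_le hab] at hu
    exact hstrain u t (ht u hu)
  refine (hmain.congr_of_eventuallyEq hcongr).congr_deriv ?_
  obtain ⟨e, he⟩ : ∃ e : ℝ → ℝ, e = fun u =>
      (deriv h u - 3 * k u * deriv k u) * form (M 2 u) (Y (u, 0))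
        + (deriv (deriv k) u - k u ^ 3 + 2 * k u * h u) * form (M 3 u) (Y (u, 0)) := ⟨_, rfl⟩
  obtain ⟨q, hq⟩ : ∃ q : ℝ → ℝ, q = fun u =>
      2 * form (-deriv h u • M 0 u - (2 * h u) • M 1 u - M 2 u)
          (partialU (partialU (partialU Y)) (u, 0))
        + 4 * (-2 * h u) * form (-h u • M 0 u - M 4 u) (partialU (partialU Y) (u, 0)) := ⟨_, rfl⟩
  have sk1 := contDiffOn_deriv hI hM.smooth_k
  have sk2 := contDiffOn_deriv hI sk1
  have sh1 := contDiffOn_deriv hI hM.smooth_h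
  have se : ContDiffOn ℝ ∞ e I := by
    rw [he]
    exact ((sh1.sub ((contDiffOn_const.mul hM.smooth_k).mul sk1)).mul
      (contDiffOn_form (hM.smooth 2) (hcont sY))).add
      (((sk2.sub (hM.smooth_k.pow 3)).add ((contDiffOn_const.mul hM.smooth_k).mul
        hM.smooth_h)).mul (contDiffOn_form (hM.smooth 3) (hcont sY)))
  have sq : ContDiffOn ℝ ∞ q I := by
    rw [hq]
    exact (contDiffOn_const.mul (contDiffOn_form (((sh1.neg.smul (hM.smooth 0)).sub
      ((contDiffOn_const.mul hM.smooth_h).smul (hM.smooth 1))).sub (hM.smooth 2))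
      (hcont sY3))).add ((contDiffOn_const.mul (contDiffOn_const.mul hM.smooth_h)).mul
      (contDiffOn_form ((hM.smooth_h.neg.smul (hM.smooth 0)).sub (hM.smooth 4)) (hcont sY2)))
  have hint {f : ℝ → ℝ} (hf : ContDiffOn ℝ ∞ f I) :
      IntervalIntegrable f MeasureTheory.volume a b :=
    (hf.continuousOn.mono ((Set.uIcc_of_le hab).trans_subset hs)).intervalIntegrable
  have hparts := intervalIntegral.integral_eq_sub_of_hasDerivAt (a := a) (b := b)
    (f' := fun u => q u - 2 * e u)
    (fun u hu => by
      rw [Set.uIcc_of_le hab] at hu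
      rw [hq, he]
      exact hM.hasDerivAt_boundary hpar hI dk dk1 dh
        (Y := fun u => Y (u, 0)) (Y₁ := fun u => partialU Y (u, 0))
        (Y₂ := fun u => partialU (partialU Y) (u, 0))
        (Y₃ := fun u => partialU (partialU (partialU Y)) (u, 0))
        (fun v hv => hasDerivAt_partialU hU sY (hU0 v hv))
        (fun v hv => hasDerivAt_partialU hU sY1 (hU0 v hv))
        (fun v hv => hasDerivAt_partialU hU sY2 (hU0 v hv)) hc0 hc1 (hs hu))
    (hint (sq.sub (contDiffOn_const.mul se)))
  simp only [z0.1, z0.2, z1.1, z1.2, z2.1, z2.2, map_zero, mul_zero, add_zero, sub_zero] at hparts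
  rw [intervalIntegral.integral_sub (hint sq) ((hint se).const_mul 2),
    intervalIntegral.integral_const_mul] at hparts
  have hl : ∫ u in a..b, 1 / 4 * (2 * form (partialU (partialU (partialU X)) (u, 0))
        (partialT (partialU (partialU (partialU X))) (u, 0))
      + 4 * form (partialU (partialU X) (u, 0)) (partialU (partialU X) (u, 0))
        * form (partialU (partialU X) (u, 0)) (partialT (partialU (partialU X)) (u, 0)))
      = 1 / 4 * ∫ u in a..b, q u := by
    rw [← intervalIntegral.integral_const_mul]
    refine intervalIntegral.integral_congr fun u hu => ?_
    rw [Set.uIcc_of_le hab] at hu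
    rw [hX22 u (hs hu), hX3 u (hs hu), hX2 u (hs hu), hT3 (hU0 u (hs hu)), hT2 (hU0 u (hs hu)), hq]
  have hr : ∫ u in a..b, (speed (deriv γ u))⁻¹ *
        ((deriv h u - 3 * k u * deriv k u) * form (M 2 u) (deriv (Γ u) 0)
        + (deriv (deriv k) u - k u ^ 3 + 2 * k u * h u) * form (M 3 u) (deriv (Γ u) 0))
      = ∫ u in a..b, e u := by
    refine intervalIntegral.integral_congr fun u hu => ?_
    rw [Set.uIcc_of_le hab] at hu
    simp only [he]
    rw [hYW u (hs hu) 2 (by simp [mobiusGram]), hYW u (hs hu) 3 (by simp [mobiusGram])]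
    ring
  rw [hl, hr]
  linarith

end IsCanonicalFrame

/-! ### Variations in prescribed normal directions -/

/-- The point of the Einstein universe on the ray of a null vector. -/
def radial (x : V) : V := (√(x 0 ^ 2 + x 1 ^ 2))⁻¹ • x

lemma radial_mem {x : V} (hx : form x x = 0) (h0 : x ≠ 0) : radial x ∈ universe12 := by
  have hpos := sq_add_sq_pos_of_null hx h0
  have hsq := Real.sq_sqrt hpos.le
  have hne := (Real.sqrt_pos.2 hpos).ne'
  rw [form_apply] at hx
  simp only [universe12, Set.mem_ofPred_eq, radial, Pi.smul_apply, smul_eq_mul]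
  constructor
  · field_simp
    linarith
  · field_simp
    linarith

lemma sqrt_smul_of_mem {x : V} (hx : x ∈ universe12) {r : ℝ} (hr : 0 < r) :
    √((r • x) 0 ^ 2 + (r • x) 1 ^ 2) = r := by
  have : (r • x) 0 ^ 2 + (r • x) 1 ^ 2 = r ^ 2 := by
    simp only [Pi.smul_apply, smul_eq_mul]
    linear_combination r ^ 2 * hx.1
  rw [this, Real.sqrt_sq hr.le]

lemma radial_smul_of_mem {x : V} (hx : x ∈ universe12) {r : ℝ} (hr : 0 < r) :
    radial (r • x) = x := by
  rw [radial, sqrt_smul_of_mem hx hr, inv_smul_smul₀ hr.ne']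

lemma contDiffOn_radial {E : Type*} [NormedAddCommGroup E] [NormedSpace ℝ E] {s : Set E}
    {Z : E → V} (hZ : ContDiffOn ℝ ∞ Z s) (hpos : ∀ p ∈ s, 0 < Z p 0 ^ 2 + Z p 1 ^ 2) :
    ContDiffOn ℝ ∞ (fun p => radial (Z p)) s := by
  have h := contDiffOn_pi.1 hZ
  refine ContDiffOn.smul (ContDiffOn.inv ?_ fun p hp => (Real.sqrt_pos.2 (hpos p hp)).ne') hZ
  exact (((h 0).pow 2).add ((h 1).pow 2)).sqrt fun p hp => (hpos p hp).ne'

lemma exists_hasDerivAt_radial {Z : ℝ → V} {Z' : V} {t : ℝ} (hZ : HasDerivAt Z Z' t)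
    (hpos : 0 < Z t 0 ^ 2 + Z t 1 ^ 2) :
    ∃ c : ℝ, HasDerivAt (fun t => radial (Z t))
      ((√(Z t 0 ^ 2 + Z t 1 ^ 2))⁻¹ • Z' + c • Z t) t := by
  have h := fun i => hasDerivAt_pi.1 hZ i
  have hc := (((((h 0).pow 2).add ((h 1).pow 2)).sqrt hpos.ne').inv
    (Real.sqrt_pos.2 hpos).ne').smul hZ
  exact ⟨_, hc⟩

namespace IsCanonicalFrame

variable {γ : ℝ → V} {I : Set ℝ} {M : Fin 5 → ℝ → V} {k h : ℝ → ℝ}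

/-- The variation of `γ` with infinitesimal displacement `y₂ M₂ + y₃ M₃` of the lift `M₀`. The
term in `M₄` keeps the varied vectors on the null cone. -/
def normalVariation (M : Fin 5 → ℝ → V) (y₂ y₃ : ℝ → ℝ) (u t : ℝ) : V :=
  M 0 u + t • (y₂ u • M 2 u + y₃ u • M 3 u) + (t ^ 2 * (y₂ u ^ 2 + y₃ u ^ 2) / 2) • M 4 u

section NormalVariation

variable {y₂ y₃ : ℝ → ℝ}

lemma form_normalVariation (hM : IsCanonicalFrame γ I M k h) {u : ℝ} (hu : u ∈ I) (t : ℝ) :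
    form (normalVariation M y₂ y₃ u t) (normalVariation M y₂ y₃ u t) = 0 := by
  simp [normalVariation, hM.form_eq hu, mobiusGram]
  ring

lemma normalVariation_ne_zero (hM : IsCanonicalFrame γ I M k h) {u : ℝ} (hu : u ∈ I) (t : ℝ) :
    normalVariation M y₂ y₃ u t ≠ 0 := fun h0 => by
  have : form (normalVariation M y₂ y₃ u t) (M 4 u) = -1 := by
    simp [normalVariation, hM.form_eq hu, mobiusGram]
  rw [h0] at this
  simp at this

lemma normalVariation_pos (hM : IsCanonicalFrame γ I M k h) {u : ℝ} (hu : u ∈ I) (t : ℝ) :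
    0 < normalVariation M y₂ y₃ u t 0 ^ 2 + normalVariation M y₂ y₃ u t 1 ^ 2 :=
  sq_add_sq_pos_of_null (hM.form_normalVariation hu t) (hM.normalVariation_ne_zero hu t)

lemma isVariation_normalVariation (hM : IsCanonicalFrame γ I M k h) (hγ : IsTimelikeCurve γ I)
    (h2 : ContDiffOn ℝ ∞ y₂ I) (h3 : ContDiffOn ℝ ∞ y₃ I) {a b ε : ℝ}
    (hs : ∀ u, u ∉ Set.Icc a b → y₂ u = 0 ∧ y₃ u = 0) :
    IsVariation γ I a b ε fun u t => radial (normalVariation M y₂ y₃ u t) where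
  smooth := by
    refine contDiffOn_radial ?_ fun p hp => hM.normalVariation_pos hp.1 p.2
    have hfst {E : Type} [NormedAddCommGroup E] [NormedSpace ℝ E] {f : ℝ → E}
        (hf : ContDiffOn ℝ ∞ f I) :
        ContDiffOn ℝ ∞ (fun p : ℝ × ℝ => f p.1) (I ×ˢ Set.Ioo (-ε) ε) :=
      hf.comp contDiffOn_fst fun p hp => hp.1
    have hsnd : ContDiffOn ℝ ∞ (fun p : ℝ × ℝ => p.2) (I ×ˢ Set.Ioo (-ε) ε) := contDiffOn_snd
    exact ((hfst (hM.smooth 0)).add (hsnd.smul (((hfst h2).smul (hfst (hM.smooth 2))).add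
      ((hfst h3).smul (hfst (hM.smooth 3)))))).add ((((hsnd.pow 2).mul
      (((hfst h2).pow 2).add ((hfst h3).pow 2))).div_const 2).smul (hfst (hM.smooth 4)))
  mem u hu t _ := radial_mem (hM.form_normalVariation hu t) (hM.normalVariation_ne_zero hu t)
  zero u hu := by
    obtain ⟨r, hr, hr'⟩ := hM.lift u hu
    simp [normalVariation, hr', radial_smul_of_mem (hγ.mem u hu) hr]
  support u hu hn t _ := by
    obtain ⟨r, hr, hr'⟩ := hM.lift u hu
    simp [normalVariation, hs u hn, hr', radial_smul_of_mem (hγ.mem u hu) hr]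

/-- The components along `M₂`, `M₃` that enter the first variation formula are `y₂` and `y₃`. -/
lemma form_deriv_normalVariation (hM : IsCanonicalFrame γ I M k h)
    (hpar : IsConformalParametrization γ I) (hI : IsOpen I) (hγ : IsTimelikeCurve γ I)
    {u : ℝ} (hu : u ∈ I) :
    (speed (deriv γ u))⁻¹ * form (M 2 u)
        (deriv (fun t => radial (normalVariation M y₂ y₃ u t)) 0) = y₂ u ∧
      (speed (deriv γ u))⁻¹ * form (M 3 u)
        (deriv (fun t => radial (normalVariation M y₂ y₃ u t)) 0) = y₃ u := by
  have hd : HasDerivAt (normalVariation M y₂ y₃ u) (y₂ u • M 2 u + y₃ u • M 3 u) 0 := by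
    have h1 := (hasDerivAt_id (0 : ℝ)).smul_const (y₂ u • M 2 u + y₃ u • M 3 u)
    have h2 := ((((hasDerivAt_id (0 : ℝ)).pow 2).mul_const (y₂ u ^ 2 + y₃ u ^ 2)).div_const
      2).smul_const (M 4 u)
    refine ((h1.const_add (M 0 u)).add h2).congr_deriv ?_
    simp
  have hs := speed_pos (hγ.timelike u hu)
  have hZ0 : normalVariation M y₂ y₃ u 0 = (speed (deriv γ u))⁻¹ • γ u := by
    have := hM.zero_eq_lift hpar hI hγ hu
    simp [normalVariation, this, conformalLift]
  obtain ⟨c, hc⟩ := exists_hasDerivAt_radial hd (hM.normalVariation_pos hu 0)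
  have hZ0' : normalVariation M y₂ y₃ u 0 = M 0 u := by simp [normalVariation]
  rw [hc.deriv, hZ0, sqrt_smul_of_mem (hγ.mem u hu) (inv_pos.2 hs), ← hZ0, hZ0']
  simp [hM.form_eq hu, mobiusGram, hs.ne']

end NormalVariation

/-- The Euler--Lagrange equations, by the first variation formula and the variations whose
components are those of the gradient times a bump function. -/
lemma isCriticalCurve_iff (hM : IsCanonicalFrame γ I M k h)
    (hpar : IsConformalParametrization γ I) (hI : IsOpen I) (hγ : IsTimelikeCurve γ I) :
    IsCriticalCurve γ I ↔ ∀ u ∈ I, deriv (deriv k) u - k u ^ 3 + 2 * k u * h u = 0 ∧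
      deriv h u - 3 * k u * deriv k u = 0 := by
  constructor
  · intro hcrit u₀ hu₀
    have sk1 := contDiffOn_deriv hI hM.smooth_k
    have sk2 := contDiffOn_deriv hI sk1
    have sh1 := contDiffOn_deriv hI hM.smooth_h
    obtain ⟨e₂, he₂⟩ : ∃ e : ℝ → ℝ, e = fun u => deriv h u - 3 * k u * deriv k u := ⟨_, rfl⟩
    obtain ⟨e₃, he₃⟩ : ∃ e : ℝ → ℝ, e = fun u => deriv (deriv k) u - k u ^ 3 + 2 * k u * h u :=
      ⟨_, rfl⟩
    have s2 : ContDiffOn ℝ ∞ e₂ I := by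
      rw [he₂]; exact sh1.sub ((contDiffOn_const.mul hM.smooth_k).mul sk1)
    have s3 : ContDiffOn ℝ ∞ e₃ I := by
      rw [he₃]
      exact (sk2.sub (hM.smooth_k.pow 3)).add ((contDiffOn_const.mul hM.smooth_k).mul hM.smooth_h)
    obtain ⟨r, hr, hrI⟩ := Metric.nhds_basis_closedBall.mem_iff.1 (hI.mem_nhds hu₀)
    rw [Real.closedBall_eq_Icc] at hrI
    let φ : ContDiffBump u₀ := ⟨r / 2, r, by positivity, by linarith⟩
    have sφ : ContDiffOn ℝ ∞ φ I := φ.contDiff.contDiffOn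
    have hφ : ∀ u, u ∉ Set.Icc (u₀ - r) (u₀ + r) → φ u = 0 := fun u hu => by
      refine φ.zero_of_le_dist ?_
      rw [← Real.closedBall_eq_Icc, Metric.mem_closedBall, not_le] at hu
      exact hu.le
    have hab : u₀ - r ≤ u₀ + r := by linarith
    -- the components of the variation are those of the gradient, cut off by `φ`
    have hvar := hM.isVariation_normalVariation hγ (sφ.mul s2) (sφ.mul s3) (ε := 1)
      (a := u₀ - r) (b := u₀ + r) fun u hu => by simp [hφ u hu]
    have hd := (hM.hasDerivAt_totalStrain hpar hI hγ hab hrI one_pos hvar).unique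
      (hcrit _ _ hab hrI 1 one_pos _ hvar)
    have hcongr : ∫ u in (u₀ - r)..(u₀ + r), φ u * (e₂ u ^ 2 + e₃ u ^ 2) = 0 := by
      rw [mul_eq_zero_iff_left (by norm_num)] at hd
      rw [← hd]
      refine intervalIntegral.integral_congr fun u hu => ?_
      rw [Set.uIcc_of_le hab] at hu
      obtain ⟨h2, h3⟩ := hM.form_deriv_normalVariation hpar hI hγ (hrI hu)
        (y₂ := fun u => φ u * e₂ u) (y₃ := fun u => φ u * e₃ u)
      change _ = (speed (deriv γ u))⁻¹ *
        ((deriv h u - 3 * k u * deriv k u) * form (M 2 u)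
          (deriv (fun t => radial (normalVariation M (fun u => φ u * e₂ u)
            (fun u => φ u * e₃ u) u t)) 0)
        + (deriv (deriv k) u - k u ^ 3 + 2 * k u * h u) * form (M 3 u)
          (deriv (fun t => radial (normalVariation M (fun u => φ u * e₂ u)
            (fun u => φ u * e₃ u) u t)) 0))
      have e2 := congrFun he₂ u
      have e3 := congrFun he₃ u
      rw [← e2, ← e3]
      linear_combination -e₂ u * h2 - e₃ u * h3
    have hzero : e₂ u₀ ^ 2 + e₃ u₀ ^ 2 = 0 := by
      by_contra hne
      have hpos : 0 < e₂ u₀ ^ 2 + e₃ u₀ ^ 2 := lt_of_le_of_ne (by positivity) (Ne.symm hne)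
      have : 0 < ∫ u in (u₀ - r)..(u₀ + r), φ u * (e₂ u ^ 2 + e₃ u ^ 2) := by
        refine intervalIntegral.integral_pos (by linarith)
          ((sφ.mul ((s2.pow 2).add (s3.pow 2))).continuousOn.mono hrI) (fun u _ => ?_)
          ⟨u₀, ⟨by linarith, by linarith⟩, ?_⟩
        · exact mul_nonneg φ.nonneg (by positivity)
        · rw [φ.one_of_mem_closedBall (Metric.mem_closedBall_self φ.rIn_pos.le), one_mul]
          exact hpos
      exact this.ne' hcongr
    have e2 : e₂ u₀ = 0 := pow_eq_zero_iff two_ne_zero |>.1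
      (by nlinarith [sq_nonneg (e₂ u₀), sq_nonneg (e₃ u₀)])
    have e3 : e₃ u₀ = 0 := pow_eq_zero_iff two_ne_zero |>.1
      (by nlinarith [sq_nonneg (e₂ u₀), sq_nonneg (e₃ u₀)])
    rw [he₂] at e2
    rw [he₃] at e3
    exact ⟨e3, e2⟩
  · intro heq a b hab hs ε hε Γ hΓ
    refine (hM.hasDerivAt_totalStrain hpar hI hγ hab hs hε hΓ).congr_deriv ?_
    rw [mul_eq_zero_iff_left (by norm_num), intervalIntegral.integral_congr (g := fun _ => 0)]
    · simp
    · intro u hu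
      rw [Set.uIcc_of_le hab] at hu
      obtain ⟨h3, h2⟩ := heq u (hs hu)
      simp only [h2, h3]
      ring

end IsCanonicalFrame

end EinsteinUniverse

end

theorem theorem10 (I : Set ℝ) (hI : IsOpen I) (hI' : I.OrdConnected) (γ : ℝ → EinsteinUniverse.V)
    (hγ : EinsteinUniverse.IsTimelikeCurve γ I) (hgen : EinsteinUniverse.IsGeneric γ I)
    (hpar : EinsteinUniverse.IsConformalParametrization γ I) :
    (∃ k h : ℝ → ℝ, EinsteinUniverse.AreConformalCurvatures γ I k h) ∧
    ∀ k h : ℝ → ℝ, EinsteinUniverse.AreConformalCurvatures γ I k h →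
      (EinsteinUniverse.IsCriticalCurve γ I ↔
        ∀ u ∈ I, iteratedDeriv 2 k u - k u ^ 3 + 2 * k u * h u = 0 ∧
          deriv h u - 3 * k u * deriv k u = 0) := by
  refine ⟨EinsteinUniverse.exists_conformalCurvatures hI hγ hpar, ?_⟩
  rintro k h ⟨M, hM⟩
  have h2 : iteratedDeriv 2 k = deriv (deriv k) := by
    rw [iteratedDeriv_succ, iteratedDeriv_one]
  rw [h2]
  exact hM.isCriticalCurve_iff hpar hI hγ
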